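/- Let $0<q<1$, let $M_{\mathfrak h^*}$ be the field of meromorphic functions on $\mathbb C$, and put $F(\lambda)=\frac{q^{2(\lambda+1)}-q^{-2}}{q^{2(\lambda+1)}-1}$, $G(\lambda)=\frac{(q^{2(\lambda+1)}-q^2)(q^{2(\lambda+1)}-q^{-2})}{(q^{2(\lambda+1)}-1)^2}$, $H(\lambda,\mu)=\frac{(q-q^{-1})(q^{2(\lambda+\mu+2)}-1)}{(q^{2(\lambda+1)}-1)(q^{2(\mu+1)}-1)}$, $I(\lambda,\mu)=\frac{(q-q^{-1})(q^{2(\mu+1)}-q^{2(\lambda+1)})}{(q^{2(\lambda+1)}-1)(q^{2(\mu+1)}-1)}$. Let $\mathcal F_R(\mathrm M(2))$ be the complex unital algebra generated by $\alpha,\beta,\gamma,\delta$ and two commuting copies of $M_{\mathfrak h^*}$, with elements written $f(\lambda)$ and $f(\mu)$, subject to $\alpha\beta=qF(\mu-1)\beta\alpha$, $\alpha\gamma=qF(\lambda)\gamma\alpha$, $\beta\delta=qF(\lambda)\delta\beta$, $\gamma\delta=qF(\mu-1)\delta\gamma$, $\alpha\delta-\delta\alpha=H(\lambda,\mu)\gamma\beta$,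 $\beta\gamma-G(\mu)\gamma\beta=I(\lambda,\mu)\delta\alpha$, and $f(\lambda)x=xf(\lambda+m)$, $f(\mu)x=xf(\mu+n)$ for $x=\alpha,\beta,\gamma,\delta$ and $(m,n)=(1,1),(1,-1),(-1,1),(-1,-1)$ respectively. It is bigraded by $\mathbb Z^2$, with these $(m,n)$ as the bidegrees of the four generators and $f(\lambda),f(\mu)$ of bidegree $(0,0)$. For an algebra $A$ with such a bigrading $A=\bigoplus A_{mn}$ and such copies of $M_{\mathfrak h^*}$, and a graded $M_{\mathfrak h^*}$-vector space $V=\bigoplus_n V_n$, put $A\widetilde\otimes V=\bigoplus_{m,n}A_{mn}\otimes_{M_{\mathfrak h^*}}V_n$, where $f(\mu)a\otimes v=a\otimes fv$. The algebra $A=\mathcal F_R(\mathrm M(2))$ is itself such a space, with $V_m=\bigoplus_nA_{mn}$ and $fv=f(\lambda)v$; then $A\widetilde\otimes A$ is an algebra under $(a\otimes b)(c\otimes d)=ac\otimes bd$, and the coproduct is the algebra homomorphism $\Delta:A\to A\widetilde\otimes A$ with $\Delta(\alpha)=\alpha\otimes\alpha+\beta\otimes\gamma$, $\Delta(\beta)=\alpha\otimes\beta+\beta\otimes\delta$,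 $\Delta(\gamma)=\gamma\otimes\alpha+\delta\otimes\gamma$, $\Delta(\delta)=\gamma\otimes\beta+\delta\otimes\delta$, $\Delta(f(\lambda))=f(\lambda)\otimes1$, $\Delta(f(\mu))=1\otimes f(\mu)$. Let $\mathcal F_R(\mathrm{SL}(2))$ be the quotient of $\mathcal F_R(\mathrm M(2))$ by the relation $\alpha\delta-qF(\lambda)\gamma\beta=1$. For an integer $N\ge0$ let $V_N\subseteq\mathcal F_R(\mathrm M(2))$ be the span of $\gamma^{N-k}\alpha^k$, $0\le k\le N$, over the functions $f(\lambda)$, graded by the first degree. Then $\Delta(V_N)\subseteq\mathcal F_R(\mathrm M(2))\widetilde\otimes V_N$; composing $\Delta|_{V_N}$ with the quotient map in the first factor gives the corepresentation $\pi_N:V_N\to\mathcal F_R(\mathrm{SL}(2))\widetilde\otimes V_N$. An intertwiner $\phi:V_M\to V_N$ is a grade-preserving $M_{\mathfrak h^*}$-linear map with $\pi_N\circ\phi=(\mathrm{id}\otimes\phi)\circ\pi_M$. Statement (Schur's lemma). If $M\ne N$, every intertwiner $V_M\to V_N$ is $0$. For every $N$, every intertwiner $\phi:V_N\to V_N$ is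 of the form $\phi=Z\,\mathrm{id}$ for a constant $Z\in\mathbb C$. -/

import Mathlib

open scoped TensorProduct

namespace DynSL2

/-! ### The field of meromorphic functions on the complex plane -/

/-- Functions `ℂ → ℂ` that are meromorphic on the whole plane (with arbitrary values at the
poles). -/
def merFun : Subalgebra ℂ (ℂ → ℂ) where
  carrier := {f | Meromorphic f}
  mul_mem' hf hg := hf.mul hg
  add_mem' hf hg := hf.add hg
  algebraMap_mem' z := Meromorphic.const (𝕜 := ℂ) z

/-- The functions that vanish off a closed discrete set. -/
def merNull : Ideal merFun where
  carrier := {f | (f : ℂ → ℂ) =ᶠ[Filter.codiscrete ℂ] 0}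
  add_mem' {f g} hf hg := by
    change ∀ᶠ x in Filter.codiscrete ℂ, (f : ℂ → ℂ) x + (g : ℂ → ℂ) x = 0
    filter_upwards [hf, hg] with x hx hy
    rw [hx, hy]; exact add_zero _
  zero_mem' := by
    change ∀ᶠ x in Filter.codiscrete ℂ, (0 : ℂ) = 0
    exact Filter.Eventually.of_forall fun _ => rfl
  smul_mem' c f hf := by
    change ∀ᶠ x in Filter.codiscrete ℂ, (c : ℂ → ℂ) x * (f : ℂ → ℂ) x = 0
    filter_upwards [hf] with x hx
    rw [hx]; exact mul_zero _

instance merNull_isMaximal : merNull.IsMaximal := by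
  rw [Ideal.Quotient.maximal_ideal_iff_isField_quotient]
  refine ⟨⟨0, 1, fun h => ?_⟩, fun x y => mul_comm x y, fun {a} ha => ?_⟩
  · have h1 : (1 : merFun) ∈ merNull := by
      rw [← Ideal.Quotient.eq_zero_iff_mem, map_one]; exact h.symm
    have h2 : ∀ᶠ x in Filter.codiscrete ℂ, (1 : ℂ) = 0 := h1
    rw [Filter.codiscrete, Filter.Eventually, mem_codiscreteWithin_iff_forall_mem_nhdsNE] at h2
    have h4 := h2 0 trivial
    simp only [one_ne_zero, Set.ofPred_false, Set.compl_univ, Set.union_empty,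
      Filter.empty_mem_iff_bot] at h4
    exact (inferInstance : (nhdsWithin (0 : ℂ) {0}ᶜ).NeBot).ne h4
  · obtain ⟨f, rfl⟩ := Ideal.Quotient.mk_surjective a
    have hf : f ∉ merNull := fun h => ha (Ideal.Quotient.eq_zero_iff_mem.2 h)
    refine ⟨Ideal.Quotient.mk _ ⟨(f : ℂ → ℂ)⁻¹, f.2.inv⟩, ?_⟩
    rw [← map_mul, ← map_one (Ideal.Quotient.mk merNull), Ideal.Quotient.eq]
    have hne : ∀ x, meromorphicOrderAt (f : ℂ → ℂ) x ≠ ⊤ := by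
      by_contra! hcon
      obtain ⟨x, hx⟩ := hcon
      apply hf
      have key : ∀ y, meromorphicOrderAt (f : ℂ → ℂ) y = ⊤ := by
        intro y
        by_contra hy
        exact MeromorphicOn.meromorphicOrderAt_ne_top_of_isPreconnected
          (f.2.meromorphicOn (s := Set.univ)) isPreconnected_univ (x := y) trivial trivial hy hx
      change ∀ᶠ x in Filter.codiscrete ℂ, (f : ℂ → ℂ) x = 0
      rw [Filter.codiscrete, Filter.Eventually, mem_codiscreteWithin_iff_forall_mem_nhdsNE]
      intro y _
      rw [Set.compl_univ, Set.union_empty]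
      exact meromorphicOrderAt_eq_top_iff.1 (key y)
    have h0 := MeromorphicOn.eventually_codiscreteWithin_apply_ne_zero
      (f.2.meromorphicOn (s := Set.univ)) (fun x _ => hne x)
    change _ =ᶠ[Filter.codiscrete ℂ] 0
    filter_upwards [h0] with x hx
    simp [mul_inv_cancel₀ hx]

/-- The field of meromorphic functions on `ℂ`: two functions are identified when they agree off
a closed discrete set. -/
def Mer : Type := merFun ⧸ merNull

noncomputable instance : Field Mer := Ideal.Quotient.field merNull
noncomputable instance : Algebra ℂ Mer := inferInstanceAs (Algebra ℂ (merFun ⧸ merNull))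

/-- The class of a meromorphic function. -/
noncomputable def Mer.mk (f : ℂ → ℂ) (hf : Meromorphic f) : Mer :=
  Ideal.Quotient.mk merNull ⟨f, hf⟩

/-- Translation of functions, `f ↦ f(· + a)`. -/
def merFunShift (a : ℂ) : merFun →ₐ[ℂ] merFun where
  toFun f := ⟨fun x => (f : ℂ → ℂ) (x + a), Meromorphic.meromorphic_fun_comp_add_const_iff_meromorphic.2 f.2⟩
  map_one' := rfl
  map_mul' _ _ := rfl
  map_zero' := rfl
  map_add' _ _ := rfl
  commutes' _ := rfl

lemma merNull_le_comap (a : ℂ) : merNull ≤ merNull.comap (merFunShift a) := by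
  intro f hf
  have hf' : ∀ᶠ x in Filter.codiscrete ℂ, (f : ℂ → ℂ) x = 0 := hf
  change ∀ᶠ x in Filter.codiscrete ℂ, (f : ℂ → ℂ) (x + a) = 0
  rw [Filter.codiscrete, Filter.Eventually, mem_codiscreteWithin_iff_forall_mem_nhdsNE] at hf' ⊢
  intro y _
  have h1 := hf' (y + a) trivial
  simp only [Set.compl_univ, Set.union_empty] at h1 ⊢
  have h2 : Filter.Tendsto (fun x : ℂ => x + a) (nhdsWithin y {y}ᶜ)
      (nhdsWithin (y + a) {y + a}ᶜ) := by
    refine tendsto_nhdsWithin_of_tendsto_nhds_of_eventually_within _ ?_ ?_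
    · exact ((continuous_id.add continuous_const).tendsto y).mono_left nhdsWithin_le_nhds
    · filter_upwards [self_mem_nhdsWithin] with x hx
      simpa using hx
  exact h2 h1

/-- The automorphism `T_a f(λ) = f(λ + a)` of the field of meromorphic functions. -/
noncomputable def shift (a : ℂ) : Mer →ₐ[ℂ] Mer :=
  Ideal.quotientMapₐ merNull (merFunShift a) (merNull_le_comap a)

lemma shift_mk (a : ℂ) (f : ℂ → ℂ) (hf : Meromorphic f) :
    shift a (Mer.mk f hf) = Mer.mk (fun x => f (x + a))
      (Meromorphic.meromorphic_fun_comp_add_const_iff_meromorphic.2 hf) := rfl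

lemma Mer.exists_mk (f : Mer) : ∃ (g : ℂ → ℂ) (hg : Meromorphic g), f = Mer.mk g hg := by
  obtain ⟨g, rfl⟩ := Ideal.Quotient.mk_surjective f
  exact ⟨g, g.2, rfl⟩

lemma shift_shift (a b : ℂ) (f : Mer) : shift a (shift b f) = shift (a + b) f := by
  obtain ⟨g, hg, rfl⟩ := f.exists_mk
  simp only [shift_mk, add_assoc]

lemma shift_zero (f : Mer) : shift 0 f = f := by
  obtain ⟨g, hg, rfl⟩ := f.exists_mk
  simp only [shift_mk, add_zero]

/-! ### The auxiliary functions -/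

/-- The deformation parameter `q`, with `0 < q < 1`. -/
abbrev QParam : Type := Set.Ioo (0 : ℝ) 1

/-- The parameter `q` as a complex number. -/
noncomputable def QParam.val (q : QParam) : ℂ := ((q : ℝ) : ℂ)

lemma QParam.ne_zero (q : QParam) : q.val ≠ 0 := Complex.ofReal_ne_zero.2 q.2.1.ne'

lemma QParam.sq_ne_one (q : QParam) : q.val ^ 2 ≠ 1 := by
  intro h
  rw [QParam.val] at h
  have h1 : ((q : ℝ) : ℝ) ^ 2 = 1 := by exact_mod_cast h
  have h2 := q.2.1
  have h3 := q.2.2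
  nlinarith

lemma meromorphic_qpow (q : QParam) : Meromorphic fun l : ℂ => q.val ^ (2 * (l + 1)) := by
  intro x
  apply AnalyticAt.meromorphicAt
  have : (fun l : ℂ => q.val ^ (2 * (l + 1))) =
      fun l => Complex.exp (Complex.log q.val * (2 * (l + 1))) := by
    funext l; rw [Complex.cpow_def_of_ne_zero q.ne_zero]
  rw [this]
  fun_prop

/-- The meromorphic function `λ ↦ q ^ (2(λ+1))`. -/
noncomputable def fQ (q : QParam) : Mer :=
  Mer.mk (fun l => q.val ^ (2 * (l + 1))) (meromorphic_qpow q)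

/-- A complex number, as a constant function. -/
noncomputable abbrev cst (z : ℂ) : Mer := algebraMap ℂ Mer z

lemma cst_zero : cst 0 = 0 := map_zero _
lemma cst_one : cst 1 = 1 := map_one _
lemma cst_sub (a b : ℂ) : cst (a - b) = cst a - cst b := map_sub _ a b
lemma cst_mul (a b : ℂ) : cst (a * b) = cst a * cst b := map_mul _ a b
lemma cst_injective : Function.Injective cst := (algebraMap ℂ Mer).injective

/-- `F(λ) = (q^{2(λ+1)} - q^{-2}) / (q^{2(λ+1)} - 1)`. -/
noncomputable def fF (q : QParam) : Mer := (fQ q - cst (q.val⁻¹ ^ 2)) / (fQ q - 1)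

/-- `G(λ) = (q^{2(λ+1)} - q^2)(q^{2(λ+1)} - q^{-2}) / (q^{2(λ+1)} - 1)^2`. -/
noncomputable def fG (q : QParam) : Mer :=
  (fQ q - cst (q.val ^ 2)) * (fQ q - cst (q.val⁻¹ ^ 2)) / (fQ q - 1) ^ 2

/-- `H(λ,μ) = (q - q⁻¹)(q^{2(λ+μ+2)} - 1) / ((q^{2(λ+1)} - 1)(q^{2(μ+1)} - 1))`, where the functions
of `λ` and of `μ` are put into a `ℂ`-algebra `R` by the maps `l` and `m`. -/
noncomputable def fH (q : QParam) {R : Type} [Ring R] [Algebra ℂ R] (l m : Mer → R) : R :=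
  (q.val - q.val⁻¹) • ((l (fQ q) * m (fQ q) - 1) * (l (fQ q - 1)⁻¹ * m (fQ q - 1)⁻¹))

/-- `I(λ,μ) = (q - q⁻¹)(q^{2(μ+1)} - q^{2(λ+1)}) / ((q^{2(λ+1)} - 1)(q^{2(μ+1)} - 1))`. -/
noncomputable def fI (q : QParam) {R : Type} [Ring R] [Algebra ℂ R] (l m : Mer → R) : R :=
  (q.val - q.val⁻¹) • ((m (fQ q) - l (fQ q)) * (l (fQ q - 1)⁻¹ * m (fQ q - 1)⁻¹))

lemma shift_fQ (q : QParam) : shift (-1) (fQ q) = cst (q.val⁻¹ ^ 2) * fQ q := by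
  rw [fQ, shift_mk]
  change _ = Mer.mk (fun l => q.val⁻¹ ^ 2 * q.val ^ (2 * (l + 1))) _
  congr 1
  funext l
  have : (2 * (l + -1 + 1) : ℂ) = 2 * (l + 1) - 2 := by ring
  rw [this, Complex.cpow_sub _ _ q.ne_zero]
  have h2 : q.val ^ (2 : ℂ) = q.val ^ 2 := by
    exact_mod_cast Complex.cpow_natCast q.val 2
  rw [h2, inv_pow, div_eq_mul_inv, mul_comm]

lemma fQ_ne_zero (q : QParam) : fQ q ≠ 0 := by
  have : fQ q * Mer.mk (fun l => (q.val ^ (2 * (l + 1)))⁻¹) (meromorphic_qpow q).inv = 1 := by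
    change Mer.mk (fun l => q.val ^ (2 * (l + 1)) * (q.val ^ (2 * (l + 1)))⁻¹) _ =
      Mer.mk (fun _ => 1) _
    congr 1
    funext l
    exact mul_inv_cancel₀ (by rw [Ne, Complex.cpow_eq_zero_iff]; exact fun h => q.ne_zero h.1)
  exact left_ne_zero_of_mul_eq_one this

lemma fQ_ne_cst (q : QParam) (z : ℂ) : fQ q - cst z ≠ 0 := by
  intro h
  have h1 : fQ q = cst z := sub_eq_zero.1 h
  have h2 := shift_fQ q
  rw [h1, AlgHom.commutes, ← map_mul] at h2
  have h3 := (algebraMap ℂ Mer).injective h2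
  have hz : z ≠ 0 := by
    rintro rfl
    rw [cst_zero] at h1
    exact fQ_ne_zero q h1
  have h4 : q.val⁻¹ ^ 2 = 1 := by
    apply mul_right_cancel₀ hz
    rw [one_mul]; exact h3.symm
  apply q.sq_ne_one
  rw [inv_pow, inv_eq_one] at h4
  exact h4

/-- `1 / (q^{2(λ+1)} - 1)`. -/
noncomputable def fP (q : QParam) : Mer := (fQ q - 1)⁻¹

lemma fQ_sub_one_ne (q : QParam) : fQ q - 1 ≠ 0 := by
  simpa using fQ_ne_cst q 1

lemma fQ_mul_fP (q : QParam) : fQ q * fP q = 1 + fP q := by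
  have := mul_inv_cancel₀ (fQ_sub_one_ne q)
  rw [fP]; linear_combination this

lemma fF_eq (q : QParam) : fF q = 1 + cst (1 - q.val⁻¹ ^ 2) * fP q := by
  rw [fF, div_eq_mul_inv, ← fP, cst_sub, cst_one]
  linear_combination fQ_mul_fP q

lemma shift_fF_inv (q : QParam) : (shift (-1) (fF q))⁻¹ = 1 + cst (1 - q.val ^ 2) * fP q := by
  rw [fF, map_div₀, map_sub, map_sub, shift_fQ, AlgHom.commutes, map_one, inv_div]
  change _ / (cst _ * fQ q - cst _) = _
  have h1 := fQ_sub_one_ne q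
  have hq : cst (q.val⁻¹ ^ 2) ≠ 0 := by
    rw [Ne, ← cst_zero, cst_injective.eq_iff]; exact pow_ne_zero _ (inv_ne_zero q.ne_zero)
  have hqq : cst (q.val⁻¹ ^ 2) * cst (q.val ^ 2) = 1 := by
    rw [← cst_mul, ← mul_pow, inv_mul_cancel₀ q.ne_zero, one_pow, cst_one]
  have h2 := fQ_mul_fP q
  rw [div_eq_iff (by rw [← mul_sub_one]; exact mul_ne_zero hq h1), cst_sub, cst_one]
  linear_combination (-cst (q.val⁻¹ ^ 2) * (1 - cst (q.val ^ 2))) * h2 + hqq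

lemma shift_fF_ne_zero (q : QParam) : shift (-1) (fF q) ≠ 0 := by
  refine (map_ne_zero (shift (-1))).2 ?_
  rw [fF]
  exact div_ne_zero (fQ_ne_cst q _) (fQ_sub_one_ne q)

lemma fG_eq (q : QParam) :
    fG q = (1 + cst (1 - q.val⁻¹ ^ 2) * fP q) * (1 + cst (1 - q.val ^ 2) * fP q) := by
  have h2 := fQ_mul_fP q
  have e1 : (fQ q - cst (q.val⁻¹ ^ 2)) * fP q = 1 + cst (1 - q.val⁻¹ ^ 2) * fP q := by
    rw [cst_sub, cst_one]; linear_combination h2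
  have e2 : (fQ q - cst (q.val ^ 2)) * fP q = 1 + cst (1 - q.val ^ 2) * fP q := by
    rw [cst_sub, cst_one]; linear_combination h2
  rw [← e1, ← e2, fG, fP, div_eq_mul_inv, ← inv_pow]
  ring

/-! ### The algebra `F_R(M(2))` -/

/-- The generators of `F_R(M(2))`: four generators `α`, `β`, `γ`, `δ` and two copies of the
meromorphic functions, written as `f(λ)` and `f(μ)`. -/
inductive Gen : Type
  | α | β | γ | δ
  | lam (f : Mer)
  | mu (f : Mer)

open Gen in
/-- The defining relations of `F_R(M(2))`. -/
inductive Rel (q : QParam) : FreeAlgebra ℂ Gen → FreeAlgebra ℂ Gen → Prop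
  -- the two copies of the field of meromorphic functions are commuting subalgebras
  | lam_const (z : ℂ) : Rel q (.ι ℂ (lam (algebraMap ℂ Mer z))) (algebraMap ℂ _ z)
  | lam_add (f g : Mer) : Rel q (.ι ℂ (lam (f + g))) (.ι ℂ (lam f) + .ι ℂ (lam g))
  | lam_mul (f g : Mer) : Rel q (.ι ℂ (lam (f * g))) (.ι ℂ (lam f) * .ι ℂ (lam g))
  | mu_const (z : ℂ) : Rel q (.ι ℂ (mu (algebraMap ℂ Mer z))) (algebraMap ℂ _ z)
  | mu_add (f g : Mer) : Rel q (.ι ℂ (mu (f + g))) (.ι ℂ (mu f) + .ι ℂ (mu g))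
  | mu_mul (f g : Mer) : Rel q (.ι ℂ (mu (f * g))) (.ι ℂ (mu f) * .ι ℂ (mu g))
  | lam_mu (f g : Mer) : Rel q (.ι ℂ (lam f) * .ι ℂ (mu g)) (.ι ℂ (mu g) * .ι ℂ (lam f))
  -- the dynamical relations
  | lam_α (f : Mer) : Rel q (.ι ℂ (lam f) * .ι ℂ α) (.ι ℂ α * .ι ℂ (lam (shift 1 f)))
  | mu_α (f : Mer) : Rel q (.ι ℂ (mu f) * .ι ℂ α) (.ι ℂ α * .ι ℂ (mu (shift 1 f)))
  | lam_β (f : Mer) : Rel q (.ι ℂ (lam f) * .ι ℂ β) (.ι ℂ β * .ι ℂ (lam (shift 1 f)))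
  | mu_β (f : Mer) : Rel q (.ι ℂ (mu f) * .ι ℂ β) (.ι ℂ β * .ι ℂ (mu (shift (-1) f)))
  | lam_γ (f : Mer) : Rel q (.ι ℂ (lam f) * .ι ℂ γ) (.ι ℂ γ * .ι ℂ (lam (shift (-1) f)))
  | mu_γ (f : Mer) : Rel q (.ι ℂ (mu f) * .ι ℂ γ) (.ι ℂ γ * .ι ℂ (mu (shift 1 f)))
  | lam_δ (f : Mer) : Rel q (.ι ℂ (lam f) * .ι ℂ δ) (.ι ℂ δ * .ι ℂ (lam (shift (-1) f)))
  | mu_δ (f : Mer) : Rel q (.ι ℂ (mu f) * .ι ℂ δ) (.ι ℂ δ * .ι ℂ (mu (shift (-1) f)))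
  -- `αβ = q F(μ-1) βα`, `αγ = q F(λ) γα`, `βδ = q F(λ) δβ`, `γδ = q F(μ-1) δγ`
  | αβ : Rel q (.ι ℂ α * .ι ℂ β) (q.val • (.ι ℂ (mu (shift (-1) (fF q))) * (.ι ℂ β * .ι ℂ α)))
  | αγ : Rel q (.ι ℂ α * .ι ℂ γ) (q.val • (.ι ℂ (lam (fF q)) * (.ι ℂ γ * .ι ℂ α)))
  | βδ : Rel q (.ι ℂ β * .ι ℂ δ) (q.val • (.ι ℂ (lam (fF q)) * (.ι ℂ δ * .ι ℂ β)))
  | γδ : Rel q (.ι ℂ γ * .ι ℂ δ) (q.val • (.ι ℂ (mu (shift (-1) (fF q))) * (.ι ℂ δ * .ι ℂ γ)))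
  -- `αδ - δα = H(λ,μ) γβ` and `βγ - G(μ) γβ = I(λ,μ) δα`
  | cross₁ : Rel q (.ι ℂ α * .ι ℂ δ - .ι ℂ δ * .ι ℂ α)
      (fH q (fun f => .ι ℂ (lam f)) (fun f => .ι ℂ (mu f)) * (.ι ℂ γ * .ι ℂ β))
  | cross₂ : Rel q (.ι ℂ β * .ι ℂ γ - .ι ℂ (mu (fG q)) * (.ι ℂ γ * .ι ℂ β))
      (fI q (fun f => .ι ℂ (lam f)) (fun f => .ι ℂ (mu f)) * (.ι ℂ δ * .ι ℂ α))

/-- The algebra `F_R(M(2))`. -/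
def FM (q : QParam) : Type := RingQuot (Rel q)

noncomputable instance (q : QParam) : Ring (FM q) := inferInstanceAs (Ring (RingQuot (Rel q)))
noncomputable instance (q : QParam) : Algebra ℂ (FM q) :=
  inferInstanceAs (Algebra ℂ (RingQuot (Rel q)))

namespace FM

variable (q : QParam)

/-- The quotient map from the free algebra. -/
noncomputable def ofFree : FreeAlgebra ℂ Gen →ₐ[ℂ] FM q := RingQuot.mkAlgHom ℂ (Rel q)

variable {q} in
lemma ofFree_rel {x y : FreeAlgebra ℂ Gen} (h : Rel q x y) : ofFree q x = ofFree q y :=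
  RingQuot.mkAlgHom_rel ℂ h

/-- The image of a generator. -/
noncomputable def gen (g : Gen) : FM q := ofFree q (FreeAlgebra.ι ℂ g)

/-- The generator `α`. -/
noncomputable abbrev α : FM q := gen q .α
/-- The generator `β`. -/
noncomputable abbrev β : FM q := gen q .β
/-- The generator `γ`. -/
noncomputable abbrev γ : FM q := gen q .γ
/-- The generator `δ`. -/
noncomputable abbrev δ : FM q := gen q .δ

lemma ofFree_smul (z : ℂ) (x : FreeAlgebra ℂ Gen) : ofFree q (z • x) = z • ofFree q x :=
  map_smul (ofFree q) z x

lemma gen_def (g : Gen) : gen q g = ofFree q (FreeAlgebra.ι ℂ g) := rfl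

/-- The left moment map `f ↦ f(λ)`. -/
noncomputable def lam : Mer →ₐ[ℂ] FM q where
  toFun f := gen q (.lam f)
  map_one' := by
    have := ofFree_rel (Rel.lam_const (q := q) 1)
    simpa only [← gen_def, map_one] using this
  map_zero' := by
    have := ofFree_rel (Rel.lam_const (q := q) 0)
    simpa only [← gen_def, map_zero] using this
  map_add' f g := by
    have := ofFree_rel (Rel.lam_add (q := q) f g)
    simpa only [← gen_def, map_add] using this
  map_mul' f g := by
    have := ofFree_rel (Rel.lam_mul (q := q) f g)
    simpa only [← gen_def, map_mul] using this
  commutes' z := by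
    have := ofFree_rel (Rel.lam_const (q := q) z)
    simpa only [← gen_def, AlgHom.commutes] using this

/-- The right moment map `f ↦ f(μ)`. -/
noncomputable def mu : Mer →ₐ[ℂ] FM q where
  toFun f := gen q (.mu f)
  map_one' := by
    have := ofFree_rel (Rel.mu_const (q := q) 1)
    simpa only [← gen_def, map_one] using this
  map_zero' := by
    have := ofFree_rel (Rel.mu_const (q := q) 0)
    simpa only [← gen_def, map_zero] using this
  map_add' f g := by
    have := ofFree_rel (Rel.mu_add (q := q) f g)
    simpa only [← gen_def, map_add] using this
  map_mul' f g := by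
    have := ofFree_rel (Rel.mu_mul (q := q) f g)
    simpa only [← gen_def, map_mul] using this
  commutes' z := by
    have := ofFree_rel (Rel.mu_const (q := q) z)
    simpa only [← gen_def, AlgHom.commutes] using this

lemma gen_lam (f : Mer) : gen q (.lam f) = lam q f := rfl
lemma gen_mu (f : Mer) : gen q (.mu f) = mu q f := rfl

/-- The bidegrees of the generators. -/
def genDeg : Gen → ℤ × ℤ
  | .α => (1, 1)
  | .β => (1, -1)
  | .γ => (-1, 1)
  | .δ => (-1, -1)
  | .lam _ => (0, 0)
  | .mu _ => (0, 0)

/-- The component of bidegree `d = (m, n)`, which is spanned by the products of generators of total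
bidegree `(m, n)`. -/
noncomputable def bideg (d : ℤ × ℤ) : Submodule ℂ (FM q) :=
  Submodule.span ℂ {x | ∃ w : List Gen, (w.map genDeg).sum = d ∧ (w.map (gen q)).prod = x}

/-- `A_{m •} = ⨁ₙ A_{mn}`. -/
noncomputable def leftDeg (m : ℤ) : Submodule ℂ (FM q) := ⨆ n : ℤ, bideg q (m, n)

/-- `A_{• n} = ⨁ₘ A_{mn}`. -/
noncomputable def rightDeg (n : ℤ) : Submodule ℂ (FM q) := ⨆ m : ℤ, bideg q (m, n)

variable {q}

lemma commute_lam_mu (f g : Mer) : lam q f * mu q g = mu q g * lam q f := by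
  have := ofFree_rel (Rel.lam_mu (q := q) f g)
  simpa only [map_mul, ← gen_def, gen_lam, gen_mu] using this

lemma lam_mul_gen (f : Mer) (g : Gen) :
    lam q f * gen q g = gen q g * lam q (shift ((genDeg g).1 : ℂ) f) := by
  rcases g with _ | _ | _ | _ | g | g
  · simpa [genDeg, ← gen_def, gen_lam, gen_mu] using ofFree_rel (Rel.lam_α (q := q) f)
  · simpa [genDeg, ← gen_def, gen_lam, gen_mu] using ofFree_rel (Rel.lam_β (q := q) f)
  · simpa [genDeg, ← gen_def, gen_lam, gen_mu] using ofFree_rel (Rel.lam_γ (q := q) f)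
  · simpa [genDeg, ← gen_def, gen_lam, gen_mu] using ofFree_rel (Rel.lam_δ (q := q) f)
  · simp only [genDeg, gen_lam, Int.cast_zero, shift_zero]
    rw [← map_mul, ← map_mul, mul_comm]
  · simp only [genDeg, gen_mu, Int.cast_zero, shift_zero]
    exact commute_lam_mu f g

lemma mu_mul_gen (f : Mer) (g : Gen) :
    mu q f * gen q g = gen q g * mu q (shift ((genDeg g).2 : ℂ) f) := by
  rcases g with _ | _ | _ | _ | g | g
  · simpa [genDeg, ← gen_def, gen_lam, gen_mu] using ofFree_rel (Rel.mu_α (q := q) f)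
  · simpa [genDeg, ← gen_def, gen_lam, gen_mu] using ofFree_rel (Rel.mu_β (q := q) f)
  · simpa [genDeg, ← gen_def, gen_lam, gen_mu] using ofFree_rel (Rel.mu_γ (q := q) f)
  · simpa [genDeg, ← gen_def, gen_lam, gen_mu] using ofFree_rel (Rel.mu_δ (q := q) f)
  · simp only [genDeg, gen_lam, Int.cast_zero, shift_zero]
    exact (commute_lam_mu g f).symm
  · simp only [genDeg, gen_mu, Int.cast_zero, shift_zero]
    rw [← map_mul, ← map_mul, mul_comm]

lemma lam_mul_word (f : Mer) (w : List Gen) :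
    lam q f * (w.map (gen q)).prod =
      (w.map (gen q)).prod * lam q (shift ((w.map genDeg).sum.1 : ℂ) f) := by
  induction w generalizing f with
  | nil => simp [shift_zero]
  | cons g w ih =>
    simp only [List.map_cons, List.prod_cons, List.sum_cons, Prod.fst_add, Int.cast_add]
    rw [← mul_assoc, lam_mul_gen, mul_assoc, ih, shift_shift, mul_assoc, add_comm]

lemma mu_mul_word (f : Mer) (w : List Gen) :
    mu q f * (w.map (gen q)).prod =
      (w.map (gen q)).prod * mu q (shift ((w.map genDeg).sum.2 : ℂ) f) := by
  induction w generalizing f with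
  | nil => simp [shift_zero]
  | cons g w ih =>
    simp only [List.map_cons, List.prod_cons, List.sum_cons, Prod.snd_add, Int.cast_add]
    rw [← mul_assoc, mu_mul_gen, mul_assoc, ih, shift_shift, mul_assoc, add_comm]

lemma lam_mul_of_leftDeg {m : ℤ} {a : FM q} (ha : a ∈ leftDeg q m) (f : Mer) :
    lam q f * a = a * lam q (shift (m : ℂ) f) := by
  have : leftDeg q m ≤ LinearMap.eqLocus (LinearMap.mulLeft ℂ (lam q f))
      (LinearMap.mulRight ℂ (lam q (shift (m : ℂ) f))) := by
    refine iSup_le fun n => Submodule.span_le.2 ?_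
    rintro _ ⟨w, hw, rfl⟩
    have := lam_mul_word (q := q) f w
    rw [hw] at this
    exact this
  exact this ha

lemma mu_mul_of_rightDeg {n : ℤ} {a : FM q} (ha : a ∈ rightDeg q n) (f : Mer) :
    mu q f * a = a * mu q (shift (n : ℂ) f) := by
  have : rightDeg q n ≤ LinearMap.eqLocus (LinearMap.mulLeft ℂ (mu q f))
      (LinearMap.mulRight ℂ (mu q (shift (n : ℂ) f))) := by
    refine iSup_le fun n => Submodule.span_le.2 ?_
    rintro _ ⟨w, hw, rfl⟩
    have := mu_mul_word (q := q) f w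
    rw [hw] at this
    exact this
  exact this ha

lemma gen_mem_bideg (g : Gen) : gen q g ∈ bideg q (genDeg g) :=
  Submodule.subset_span ⟨[g], by simp, by simp⟩

lemma one_mem_bideg : (1 : FM q) ∈ bideg q 0 :=
  Submodule.subset_span ⟨[], by simp, by simp⟩

lemma bideg_le_leftDeg (d : ℤ × ℤ) : bideg q d ≤ leftDeg q d.1 :=
  le_iSup (fun n => bideg q (d.1, n)) d.2

lemma bideg_le_rightDeg (d : ℤ × ℤ) : bideg q d ≤ rightDeg q d.2 :=
  le_iSup (fun n => bideg q (n, d.2)) d.1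

lemma bideg_mul_le (d e : ℤ × ℤ) : bideg q d * bideg q e ≤ bideg q (d + e) := by
  rw [bideg, bideg, Submodule.span_mul_span]
  refine Submodule.span_mono ?_
  rintro _ ⟨_, ⟨w, hw, rfl⟩, _, ⟨v, hv, rfl⟩, rfl⟩
  exact ⟨w ++ v, by simp [hw, hv], by simp⟩

lemma mul_mem_leftDeg {m n : ℤ} {a b : FM q} (ha : a ∈ leftDeg q m) (hb : b ∈ leftDeg q n) :
    a * b ∈ leftDeg q (m + n) := by
  have : leftDeg q m * leftDeg q n ≤ leftDeg q (m + n) := by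
    simp only [leftDeg, Submodule.iSup_mul, Submodule.mul_iSup, iSup_le_iff]
    intro i j
    exact (bideg_mul_le _ _).trans (bideg_le_leftDeg _)
  exact this (Submodule.mul_mem_mul ha hb)

lemma mul_mem_rightDeg {m n : ℤ} {a b : FM q} (ha : a ∈ rightDeg q m) (hb : b ∈ rightDeg q n) :
    a * b ∈ rightDeg q (m + n) := by
  have : rightDeg q m * rightDeg q n ≤ rightDeg q (m + n) := by
    simp only [rightDeg, Submodule.iSup_mul, Submodule.mul_iSup, iSup_le_iff]
    intro i j
    exact (bideg_mul_le _ _).trans (bideg_le_rightDeg _)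
  exact this (Submodule.mul_mem_mul ha hb)

lemma gen_mem_leftDeg (g : Gen) : gen q g ∈ leftDeg q (genDeg g).1 :=
  bideg_le_leftDeg _ (gen_mem_bideg g)

lemma gen_mem_rightDeg (g : Gen) : gen q g ∈ rightDeg q (genDeg g).2 :=
  bideg_le_rightDeg _ (gen_mem_bideg g)

lemma one_mem_leftDeg : (1 : FM q) ∈ leftDeg q 0 := bideg_le_leftDeg 0 one_mem_bideg
lemma one_mem_rightDeg : (1 : FM q) ∈ rightDeg q 0 := bideg_le_rightDeg 0 one_mem_bideg

end FM

/-! ### Matrix tensor products -/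

section Via

variable {A : Type} [Ring A] [Algebra ℂ A]

/-- The algebra `A`, viewed as a vector space over the meromorphic functions through left
multiplication by `g(f)`, where `g` is a moment map. -/
def Via (_ : Mer →ₐ[ℂ] A) : Type := A

variable (g : Mer →ₐ[ℂ] A)

instance : AddCommGroup (Via g) := inferInstanceAs (AddCommGroup A)
instance : Module ℂ (Via g) := inferInstanceAs (Module ℂ A)

/-- The identity map `A → Via g`. -/
def Via.of : A ≃ₗ[ℂ] Via g := LinearEquiv.refl ℂ A

noncomputable instance : Module Mer (Via g) := Module.compHom A g.toRingHom

lemma Via.smul_of (f : Mer) (a : A) : f • Via.of g a = Via.of g (g f * a) := rfl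

instance : IsScalarTower ℂ Mer (Via g) where
  smul_assoc z f x := by
    obtain ⟨a, rfl⟩ := (Via.of g).surjective x
    rw [Via.smul_of, Via.smul_of, ← map_smul, map_smul g, smul_mul_assoc]

instance : SMulCommClass Mer ℂ (Via g) where
  smul_comm f z x := by
    obtain ⟨a, rfl⟩ := (Via.of g).surjective x
    rw [← map_smul, Via.smul_of, Via.smul_of, ← map_smul, mul_smul_comm]

/-- Right multiplication by an element. -/
noncomputable def Via.mulRight (c : A) : Via g →ₗ[Mer] Via g where
  toFun x := Via.of g ((Via.of g).symm x * c)
  map_add' x y := by rw [map_add, add_mul, map_add]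
  map_smul' f x := by
    obtain ⟨a, rfl⟩ := (Via.of g).surjective x
    simp only [Via.smul_of, LinearEquiv.symm_apply_apply, RingHom.id_apply, mul_assoc]

/-- The tensor product `A ⊗̃ V = ⨁ₙ A_{•n} ⊗ Vₙ` over the field of meromorphic functions, inside
`A ⊗ V`. Here `f • a = r(f) a` for the right moment map `r`, the subspaces `A_{•n}` form the
grading of `A` by the right degree, and the subspaces `Vₙ` form the grading of `V`. -/
noncomputable def matTensor (r : Mer →ₐ[ℂ] A) (grA : ℤ → Submodule ℂ A)
    {V : Type} [AddCommGroup V] [Module Mer V] [Module ℂ V] (grV : ℤ → Submodule ℂ V) :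
    Submodule ℂ (Via r ⊗[Mer] V) :=
  Submodule.span ℂ {x | ∃ n : ℤ, ∃ a ∈ grA n, ∃ v ∈ grV n, Via.of r a ⊗ₜ[Mer] v = x}

end Via

namespace FM

variable (q : QParam)

/-- The grading of `F_R(M(2))` by the left degree, where `F_R(M(2))` is viewed as a vector space
over the meromorphic functions by means of the left moment map. -/
noncomputable def leftGr (n : ℤ) : Submodule ℂ (Via (lam q)) :=
  (leftDeg q n).map (Via.of (lam q)).toLinearMap

/-- The tensor product `A ⊗ A` over the meromorphic functions, where `A = F_R(M(2))`, modulo the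
relations `f(μ) a ⊗ b = a ⊗ f(λ) b`. -/
abbrev TT : Type := Via (mu q) ⊗[Mer] Via (lam q)

/-- The matrix tensor product `A ⊗̃ A`, where `A = F_R(M(2))`. -/
noncomputable def MT : Submodule ℂ (TT q) := matTensor (mu q) (rightDeg q) (leftGr q)

variable {q}

/-- The element `a ⊗ b` of `A ⊗ A`. -/
noncomputable def tm (a b : FM q) : TT q := Via.of (mu q) a ⊗ₜ[Mer] Via.of (lam q) b

lemma tm_mu (f : Mer) (a b : FM q) : tm (mu q f * a) b = tm a (lam q f * b) := by
  rw [tm, tm, ← Via.smul_of, ← Via.smul_of, TensorProduct.smul_tmul]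

lemma add_tm (a a' b : FM q) : tm (a + a') b = tm a b + tm a' b := by
  rw [tm, map_add, TensorProduct.add_tmul]; rfl

lemma tm_add (a b b' : FM q) : tm a (b + b') = tm a b + tm a b' := by
  rw [tm, map_add, TensorProduct.tmul_add]; rfl

lemma sub_tm (a a' b : FM q) : tm (a - a') b = tm a b - tm a' b := by
  rw [tm, map_sub, TensorProduct.sub_tmul]; rfl

lemma tm_sub (a b b' : FM q) : tm a (b - b') = tm a b - tm a b' := by
  rw [tm, map_sub, TensorProduct.tmul_sub]; rfl

lemma smul_tm (z : ℂ) (a b : FM q) : tm (z • a) b = z • tm a b := by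
  rw [tm, map_smul, ← TensorProduct.smul_tmul']; rfl

lemma tm_smul (z : ℂ) (a b : FM q) : tm a (z • b) = z • tm a b := by
  rw [tm, map_smul, TensorProduct.tmul_smul]; rfl

lemma TT_induction {p : TT q → Prop} (x : TT q) (h0 : p 0) (ht : ∀ a b, p (tm a b))
    (ha : ∀ x y, p x → p y → p (x + y)) : p x := by
  induction x using TensorProduct.induction_on with
  | zero => exact h0
  | tmul a b => exact ht ((Via.of _).symm a) ((Via.of _).symm b)
  | add x y hx hy => exact ha x y hx hy

lemma tm_mem {n : ℤ} {a b : FM q} (ha : a ∈ rightDeg q n) (hb : b ∈ leftDeg q n) :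
    tm a b ∈ MT q :=
  Submodule.subset_span ⟨n, a, ha, _, Submodule.mem_map_of_mem hb, rfl⟩

lemma MT_induction {p : TT q → Prop} {x : TT q} (hx : x ∈ MT q) (h0 : p 0)
    (ht : ∀ n a b, a ∈ rightDeg q n → b ∈ leftDeg q n → p (tm a b))
    (ha : ∀ x y, p x → p y → p (x + y)) (hs : ∀ (z : ℂ) x, p x → p (z • x)) : p x := by
  refine Submodule.span_induction (p := fun x _ => p x) ?_ h0 (fun x y _ _ => ha x y) ?_ hx
  · rintro _ ⟨n, a, ha, _, ⟨b, hb, rfl⟩, rfl⟩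
    exact ht n a b ha hb
  · exact fun z x _ => hs z x

/-- Multiplication by `c ⊗ d` from the right. -/
noncomputable def mulTm (c d : FM q) : TT q →ₗ[Mer] TT q :=
  TensorProduct.map (Via.mulRight (mu q) c) (Via.mulRight (lam q) d)

lemma mulTm_tm (a b c d : FM q) : mulTm c d (tm a b) = tm (a * c) (b * d) := rfl

lemma mulTm_smul (z : ℂ) (c d : FM q) (x : TT q) : mulTm c d (z • x) = z • mulTm c d x :=
  LinearMap.map_smul_of_tower _ z x

lemma mulTm_add_left (c c' d : FM q) (x : TT q) :
    mulTm (c + c') d x = mulTm c d x + mulTm c' d x := by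
  induction x using TT_induction with
  | h0 => simp
  | ht a b => simp only [mulTm_tm, mul_add, add_tm]
  | ha x y hx hy => simp only [map_add, hx, hy]; abel

lemma mulTm_add_right (c d d' : FM q) (x : TT q) :
    mulTm c (d + d') x = mulTm c d x + mulTm c d' x := by
  induction x using TT_induction with
  | h0 => simp
  | ht a b => simp only [mulTm_tm, mul_add, tm_add]
  | ha x y hx hy => simp only [map_add, hx, hy]; abel

lemma mulTm_mulTm (c d e f : FM q) (x : TT q) :
    mulTm e f (mulTm c d x) = mulTm (c * e) (d * f) x := by
  induction x using TT_induction with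
  | h0 => simp
  | ht a b => simp only [mulTm_tm, mul_assoc]
  | ha x y hx hy => simp only [map_add, hx, hy]

lemma mulTm_balanced {x : TT q} (hx : x ∈ MT q) (f : Mer) (c d : FM q) :
    mulTm (mu q f * c) d x = mulTm c (lam q f * d) x := by
  refine MT_induction (p := fun x => mulTm (mu q f * c) d x = mulTm c (lam q f * d) x) hx
    (by simp only [map_zero]) ?_ (fun x y hx hy => by simp only [map_add, hx, hy])
    (fun z x hx => by simp only [mulTm_smul, hx])
  intro n a b ha hb
  have h1 := mu_mul_of_rightDeg ha (shift (-(n : ℂ)) f)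
  have h2 := lam_mul_of_leftDeg hb (shift (-(n : ℂ)) f)
  rw [shift_shift, add_neg_cancel, shift_zero] at h1 h2
  rw [mulTm_tm, mulTm_tm, ← mul_assoc, ← mul_assoc, ← h1, ← h2, mul_assoc, mul_assoc, tm_mu]

lemma mulTm_smul_left (z : ℂ) (c d : FM q) (x : TT q) :
    mulTm (z • c) d x = z • mulTm c d x := by
  induction x using TT_induction with
  | h0 => simp
  | ht a b => simp only [mulTm_tm, mul_smul_comm, smul_tm]
  | ha x y hx hy => simp only [map_add, smul_add, hx, hy]

/-- The product `(a ⊗ b)(c ⊗ d) = ac ⊗ bd`, where the left factor is in `A ⊗̃ A` and the right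
factor is an arbitrary element of `A ⊗ A`. -/
noncomputable def act (x : MT q) : TT q →+ TT q :=
  TensorProduct.liftAddHom
    (AddMonoidHom.mk' (fun c : Via (mu q) => AddMonoidHom.mk'
        (fun d : Via (lam q) => mulTm ((Via.of _).symm c) ((Via.of _).symm d) (x : TT q))
        (fun d d' => by rw [map_add, mulTm_add_right]))
      (fun c c' => by ext d; simp only [AddMonoidHom.mk'_apply, map_add, mulTm_add_left,
        AddMonoidHom.add_apply]))
    (fun f c d => mulTm_balanced x.2 f _ _)

lemma act_tm (x : MT q) (c d : FM q) : act x (tm c d) = mulTm c d (x : TT q) := rfl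

lemma act_add_left (x x' : MT q) (y : TT q) : act (x + x') y = act x y + act x' y := by
  induction y using TT_induction with
  | h0 => simp
  | ht a b => simp only [act_tm, Submodule.coe_add, map_add]
  | ha y z hy hz => simp only [map_add, hy, hz]; abel

lemma act_smul_left (w : ℂ) (x : MT q) (y : TT q) : act (w • x) y = w • act x y := by
  induction y using TT_induction with
  | h0 => simp
  | ht a b => simp only [act_tm, Submodule.coe_smul, mulTm_smul]
  | ha y z hy hz => simp only [map_add, hy, hz, smul_add]

lemma act_smul (w : ℂ) (x : MT q) (y : TT q) : act x (w • y) = w • act x y := by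
  induction y using TT_induction with
  | h0 => simp
  | ht a b =>
    rw [← smul_tm, act_tm, act_tm, mulTm_smul_left]
  | ha y z hy hz => simp only [map_add, hy, hz, smul_add]

lemma mulTm_act (x : MT q) (y : TT q) (c d : FM q) :
    mulTm c d (act x y) = act x (mulTm c d y) := by
  induction y using TT_induction with
  | h0 => simp
  | ht a b => rw [mulTm_tm, act_tm, act_tm, mulTm_mulTm]
  | ha y z hy hz => simp only [map_add, hy, hz]

lemma mulTm_mem {x : TT q} (hx : x ∈ MT q) {n : ℤ} {c d : FM q} (hc : c ∈ rightDeg q n)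
    (hd : d ∈ leftDeg q n) : mulTm c d x ∈ MT q := by
  refine MT_induction (p := fun x => mulTm c d x ∈ MT q) hx (by simp) ?_
    (fun x y hx hy => by rw [map_add]; exact add_mem hx hy)
    (fun z x hx => by rw [mulTm_smul]; exact Submodule.smul_mem _ _ hx)
  intro m a b ha hb
  exact tm_mem (mul_mem_rightDeg ha hc) (mul_mem_leftDeg hb hd)

lemma act_mem (x : MT q) {y : TT q} (hy : y ∈ MT q) : act x y ∈ MT q := by
  refine MT_induction (p := fun y => act x y ∈ MT q) hy (by simp) ?_
    (fun x y hx hy => by rw [map_add]; exact add_mem hx hy)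
    (fun z x hx => by rw [act_smul]; exact Submodule.smul_mem _ _ hx)
  intro m a b ha hb
  rw [act_tm]
  exact mulTm_mem x.2 ha hb

noncomputable instance : Mul (MT q) := ⟨fun x y => ⟨act x y, act_mem x y.2⟩⟩
noncomputable instance : One (MT q) := ⟨⟨tm 1 1, tm_mem one_mem_rightDeg one_mem_leftDeg⟩⟩

lemma coe_mul (x y : MT q) : ((x * y : MT q) : TT q) = act x y := rfl
lemma coe_one : ((1 : MT q) : TT q) = tm 1 1 := rfl

lemma act_act (x y : MT q) (z : TT q) : act (x * y) z = act x (act y z) := by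
  induction z using TT_induction with
  | h0 => simp
  | ht a b => rw [act_tm, coe_mul, mulTm_act, act_tm]
  | ha y z hy hz => simp only [map_add, hy, hz]

lemma act_one_left (y : TT q) : act 1 y = y := by
  induction y using TT_induction with
  | h0 => simp
  | ht a b => rw [act_tm, coe_one, mulTm_tm, one_mul, one_mul]
  | ha y z hy hz => simp only [map_add, hy, hz]

lemma act_one_right (x : MT q) : act x (tm 1 1) = x := by
  rw [act_tm]
  generalize (x : TT q) = y
  induction y using TT_induction with
  | h0 => simp
  | ht a b => rw [mulTm_tm, mul_one, mul_one]
  | ha y z hy hz => simp only [map_add, hy, hz]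

/-- The algebra `A ⊗̃ A`, with the product `(a ⊗ b)(c ⊗ d) = ac ⊗ bd`. -/
noncomputable instance : Ring (MT q) where
  __ := (MT q).addCommGroup
  mul_assoc x y z := Subtype.ext (act_act x y z)
  one_mul x := Subtype.ext (act_one_left (x : TT q))
  mul_one x := Subtype.ext (act_one_right x)
  zero_mul x := Subtype.ext (by
    have := act_add_left 0 0 (x : TT q)
    rw [add_zero] at this
    simpa [coe_mul] using this)
  mul_zero x := Subtype.ext (map_zero (act x))
  left_distrib x y z := Subtype.ext (map_add (act x) (y : TT q) (z : TT q))
  right_distrib x y z := Subtype.ext (act_add_left x y z)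

noncomputable instance : Algebra ℂ (MT q) :=
  Algebra.ofModule (fun z x y => Subtype.ext (act_smul_left z x y))
    (fun z x y => Subtype.ext (act_smul z x y))

/-- The element `a ⊗ b` of `A ⊗̃ A`, for `a ∈ A_{•n}` and `b ∈ A_{n•}`. -/
noncomputable def tmul (n : ℤ) (a b : FM q) (ha : a ∈ rightDeg q n) (hb : b ∈ leftDeg q n) :
    MT q := ⟨tm a b, tm_mem ha hb⟩

lemma tmul_mul_tmul (m n : ℤ) (a b c d : FM q) (ha : a ∈ rightDeg q m) (hb : b ∈ leftDeg q m)
    (hc : c ∈ rightDeg q n) (hd : d ∈ leftDeg q n) :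
    tmul m a b ha hb * tmul n c d hc hd =
      tmul (m + n) (a * c) (b * d) (mul_mem_rightDeg ha hc) (mul_mem_leftDeg hb hd) := rfl

end FM

/-! ### Consequences of the relations

All coefficient functions are expressed through `P = 1 / (q^{2(λ+1)} - 1)`. -/

section Coefficients

variable {R : Type} [Ring R] [Algebra ℂ R] (q : QParam)

lemma map_fF (l : Mer →ₐ[ℂ] R) (v : R) :
    l (fF q) * v = v + (1 - q.val⁻¹ ^ 2) • (l (fP q) * v) := by
  have h : l (cst (1 - q.val⁻¹ ^ 2)) = algebraMap ℂ R _ := l.commutes _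
  rw [fF_eq, map_add, map_mul, map_one, h, ← Algebra.smul_def, add_mul, one_mul, smul_mul_assoc]

lemma map_shift_fF_inv (l : Mer →ₐ[ℂ] R) (v : R) :
    l (shift (-1) (fF q))⁻¹ * v = v + (1 - q.val ^ 2) • (l (fP q) * v) := by
  have h : l (cst (1 - q.val ^ 2)) = algebraMap ℂ R _ := l.commutes _
  rw [shift_fF_inv, map_add, map_mul, map_one, h, ← Algebra.smul_def, add_mul, one_mul,
    smul_mul_assoc]

lemma eq_smul_shift_fF_mul_iff (m : Mer →ₐ[ℂ] R) (v w : R) :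
    v = q.val • (m (shift (-1) (fF q)) * w) ↔
      w = q.val⁻¹ • (v + (1 - q.val ^ 2) • (m (fP q) * v)) := by
  have hq := q.ne_zero
  have h0 := shift_fF_ne_zero q
  rw [← map_shift_fF_inv]
  constructor
  · rintro rfl
    rw [mul_smul_comm, smul_smul, inv_mul_cancel₀ hq, one_smul, ← mul_assoc, ← map_mul,
      inv_mul_cancel₀ h0, map_one, one_mul]
  · rintro rfl
    rw [mul_smul_comm, smul_smul, mul_inv_cancel₀ hq, one_smul, ← mul_assoc, ← map_mul,
      mul_inv_cancel₀ h0, map_one, one_mul]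

lemma map_fG (l : Mer →ₐ[ℂ] R) (v : R) :
    l (fG q) * v = v + (2 - q.val ^ 2 - q.val⁻¹ ^ 2) • (l (fP q) * v)
      + (2 - q.val ^ 2 - q.val⁻¹ ^ 2) • (l (fP q) * (l (fP q) * v)) := by
  have hq := q.ne_zero
  have : fG q = (shift (-1) (fF q))⁻¹ * fF q := by rw [fG_eq, shift_fF_inv, mul_comm, ← fF_eq]
  rw [this, map_mul, mul_assoc, map_shift_fF_inv, map_fF]
  simp only [mul_add, mul_smul_comm, smul_add, smul_smul]
  match_scalars <;> field_simp <;> ring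

lemma fH_eq (l m : Mer →ₐ[ℂ] R) (hc : ∀ f g, l f * m g = m g * l f) :
    fH q l m = (q.val - q.val⁻¹) • (1 + l (fP q) + m (fP q)) := by
  have hl : l (fQ q) * l (fP q) = 1 + l (fP q) := by rw [← map_mul, fQ_mul_fP, map_add, map_one]
  have hm : m (fQ q) * m (fP q) = 1 + m (fP q) := by rw [← map_mul, fQ_mul_fP, map_add, map_one]
  have h : l (fQ q) * m (fQ q) * (l (fP q) * m (fP q)) =
      (l (fQ q) * l (fP q)) * (m (fQ q) * m (fP q)) := by
    rw [mul_assoc, ← mul_assoc (m (fQ q)), ← hc, mul_assoc, mul_assoc]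
  rw [fH, ← fP, sub_mul, h, hl, hm, one_mul]
  congr 1
  noncomm_ring

lemma fI_eq (l m : Mer →ₐ[ℂ] R) (hc : ∀ f g, l f * m g = m g * l f) :
    fI q l m = (q.val - q.val⁻¹) • (l (fP q) - m (fP q)) := by
  have hl : l (fQ q) * l (fP q) = 1 + l (fP q) := by rw [← map_mul, fQ_mul_fP, map_add, map_one]
  have hm : m (fQ q) * m (fP q) = 1 + m (fP q) := by rw [← map_mul, fQ_mul_fP, map_add, map_one]
  have h1 : m (fQ q) * (l (fP q) * m (fP q)) = l (fP q) * (m (fQ q) * m (fP q)) := by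
    rw [← mul_assoc, ← hc, mul_assoc]
  have h2 : l (fQ q) * (l (fP q) * m (fP q)) = (l (fQ q) * l (fP q)) * m (fP q) := by
    rw [mul_assoc]
  rw [fI, ← fP, sub_mul, h1, h2, hl, hm]
  congr 1
  noncomm_ring

lemma map_fH {R' : Type} [Ring R'] [Algebra ℂ R'] (φ : R →ₐ[ℂ] R') (l m : Mer → R) :
    φ (fH q l m) = fH q (fun f => φ (l f)) (fun f => φ (m f)) := by
  simp only [fH, map_smul, map_mul, map_sub, map_one]

lemma map_fI {R' : Type} [Ring R'] [Algebra ℂ R'] (φ : R →ₐ[ℂ] R') (l m : Mer → R) :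
    φ (fI q l m) = fI q (fun f => φ (l f)) (fun f => φ (m f)) := by
  simp only [fI, map_smul, map_mul, map_sub]

end Coefficients

namespace FM

variable {q : QParam}

lemma rel_αγ : α q * γ q = q.val • (lam q (fF q) * (γ q * α q)) := by
  simpa [← gen_def, gen_lam, gen_mu, ofFree_smul] using ofFree_rel (Rel.αγ (q := q))

lemma rel_βδ : β q * δ q = q.val • (lam q (fF q) * (δ q * β q)) := by
  simpa [← gen_def, gen_lam, gen_mu, ofFree_smul] using ofFree_rel (Rel.βδ (q := q))

lemma rel_αβ : α q * β q = q.val • (mu q (shift (-1) (fF q)) * (β q * α q)) := by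
  simpa [← gen_def, gen_lam, gen_mu, ofFree_smul] using ofFree_rel (Rel.αβ (q := q))

lemma rel_γδ : γ q * δ q = q.val • (mu q (shift (-1) (fF q)) * (δ q * γ q)) := by
  simpa [← gen_def, gen_lam, gen_mu, ofFree_smul] using ofFree_rel (Rel.γδ (q := q))

lemma rel_cross₁ : α q * δ q - δ q * α q = fH q (lam q) (mu q) * (γ q * β q) := by
  have h := ofFree_rel (Rel.cross₁ (q := q))
  rw [map_sub, map_mul, map_mul, map_mul, map_mul, map_fH] at h
  exact h

lemma rel_cross₂ : β q * γ q - mu q (fG q) * (γ q * β q) =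
    fI q (lam q) (mu q) * (δ q * α q) := by
  have h := ofFree_rel (Rel.cross₂ (q := q))
  rw [map_sub, map_mul, map_mul, map_mul, map_mul, map_mul, map_fI] at h
  exact h

lemma eq_αγ : α q * γ q =
    q.val • (γ q * α q + (1 - q.val⁻¹ ^ 2) • (lam q (fP q) * (γ q * α q))) := by
  rw [rel_αγ, map_fF]

lemma eq_βδ : β q * δ q =
    q.val • (δ q * β q + (1 - q.val⁻¹ ^ 2) • (lam q (fP q) * (δ q * β q))) := by
  rw [rel_βδ, map_fF]

lemma eq_βα : β q * α q =
    q.val⁻¹ • (α q * β q + (1 - q.val ^ 2) • (mu q (fP q) * (α q * β q))) :=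
  (eq_smul_shift_fF_mul_iff q (mu q) _ _).1 rel_αβ

lemma eq_δγ : δ q * γ q =
    q.val⁻¹ • (γ q * δ q + (1 - q.val ^ 2) • (mu q (fP q) * (γ q * δ q))) :=
  (eq_smul_shift_fF_mul_iff q (mu q) _ _).1 rel_γδ

lemma eq_αδ : α q * δ q = δ q * α q + (q.val - q.val⁻¹) •
    (γ q * β q + lam q (fP q) * (γ q * β q) + mu q (fP q) * (γ q * β q)) := by
  rw [← sub_eq_iff_eq_add', rel_cross₁, fH_eq q _ _ commute_lam_mu]
  simp only [smul_mul_assoc, add_mul, one_mul]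

lemma eq_βγ : β q * γ q = mu q (fG q) * (γ q * β q) + (q.val - q.val⁻¹) •
    (lam q (fP q) * (δ q * α q) - mu q (fP q) * (δ q * α q)) := by
  rw [← sub_eq_iff_eq_add', rel_cross₂, fI_eq q _ _ commute_lam_mu]
  simp only [smul_mul_assoc, sub_mul]

lemma eq_βγ' : β q * γ q = lam q (fG q) * (γ q * β q) + (q.val - q.val⁻¹) •
    (lam q (fP q) * (α q * δ q) - mu q (fP q) * (α q * δ q)) := by
  have hq := q.ne_zero
  have hc : ∀ w : FM q, mu q (fP q) * (lam q (fP q) * w) = lam q (fP q) * (mu q (fP q) * w) :=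
    fun w => by rw [← mul_assoc, ← commute_lam_mu, mul_assoc]
  rw [eq_βγ, eq_αδ, map_fG, map_fG]
  generalize γ q * β q = v, δ q * α q = u
  simp only [mul_add, mul_smul_comm, hc]
  match_scalars <;> field_simp <;> ring

lemma eq_G_αδ : mu q (fG q) * (α q * δ q) = lam q (fG q) * (δ q * α q) + (q.val - q.val⁻¹) •
    (β q * γ q + lam q (fP q) * (β q * γ q) + mu q (fP q) * (β q * γ q)) := by
  have hq := q.ne_zero
  have hc : ∀ w : FM q, mu q (fP q) * (lam q (fP q) * w) = lam q (fP q) * (mu q (fP q) * w) :=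
    fun w => by rw [← mul_assoc, ← commute_lam_mu, mul_assoc]
  rw [eq_βγ, eq_αδ]
  simp only [map_fG]
  generalize γ q * β q = v, δ q * α q = u
  simp only [mul_add, mul_sub, mul_smul_comm, hc]
  match_scalars <;> field_simp <;> ring

lemma eq_G_αβ : mu q (fG q) * (α q * β q) =
    q.val • (β q * α q + (1 - q.val⁻¹ ^ 2) • (mu q (fP q) * (β q * α q))) := by
  have hq := q.ne_zero
  rw [eq_βα, map_fG]
  generalize α q * β q = v
  simp only [mul_add, mul_smul_comm]
  match_scalars <;> field_simp <;> ring

lemma eq_G_γδ : mu q (fG q) * (γ q * δ q) =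
    q.val • (δ q * γ q + (1 - q.val⁻¹ ^ 2) • (mu q (fP q) * (δ q * γ q))) := by
  have hq := q.ne_zero
  rw [eq_δγ, map_fG]
  generalize γ q * δ q = v
  simp only [mul_add, mul_smul_comm]
  match_scalars <;> field_simp <;> ring

lemma eq_mid₁ :
    q.val⁻¹ • (α q * δ q + (1 - q.val ^ 2) • (mu q (fP q) * (α q * δ q))) +
      q.val⁻¹ ^ 2 • (γ q * β q + (1 - q.val ^ 2) • (lam q (fP q) * (γ q * β q)) +
        (1 - q.val ^ 2) • (mu q (fP q) * (γ q * β q)) +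
        (1 - q.val ^ 2) ^ 2 • (lam q (fP q) * (mu q (fP q) * (γ q * β q)))) =
    β q * γ q + q.val⁻¹ • (δ q * α q + (1 - q.val ^ 2) • (lam q (fP q) * (δ q * α q))) := by
  have hq := q.ne_zero
  have hc : ∀ w : FM q, mu q (fP q) * (lam q (fP q) * w) = lam q (fP q) * (mu q (fP q) * w) :=
    fun w => by rw [← mul_assoc, ← commute_lam_mu, mul_assoc]
  rw [eq_βγ, eq_αδ, map_fG]
  generalize γ q * β q = v, δ q * α q = u
  simp only [mul_add, mul_smul_comm, hc]
  match_scalars <;> field_simp <;> ring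

lemma eq_mid₂ :
    q.val • (α q * δ q + (1 - q.val⁻¹ ^ 2) • (mu q (fP q) * (α q * δ q))) + β q * γ q =
    q.val • (δ q * α q + (1 - q.val⁻¹ ^ 2) • (lam q (fP q) * (δ q * α q))) +
      q.val ^ 2 • (γ q * β q + (1 - q.val⁻¹ ^ 2) • (lam q (fP q) * (γ q * β q)) +
        (1 - q.val⁻¹ ^ 2) • (mu q (fP q) * (γ q * β q)) +
        (1 - q.val⁻¹ ^ 2) ^ 2 • (lam q (fP q) * (mu q (fP q) * (γ q * β q)))) := by
  have hq := q.ne_zero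
  have hc : ∀ w : FM q, mu q (fP q) * (lam q (fP q) * w) = lam q (fP q) * (mu q (fP q) * w) :=
    fun w => by rw [← mul_assoc, ← commute_lam_mu, mul_assoc]
  rw [eq_βγ, eq_αδ, map_fG]
  generalize γ q * β q = v, δ q * α q = u
  simp only [mul_add, mul_smul_comm, hc]
  match_scalars <;> field_simp <;> ring

end FM

/-! ### The coproduct -/

namespace FM

variable {q : QParam}

lemma mem_right (g : Gen) {n : ℤ} (h : (genDeg g).2 = n) : gen q g ∈ rightDeg q n :=
  h ▸ gen_mem_rightDeg g

lemma mem_left (g : Gen) {n : ℤ} (h : (genDeg g).1 = n) : gen q g ∈ leftDeg q n :=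
  h ▸ gen_mem_leftDeg g

variable (q)

/-- `Δ(α) = α ⊗ α + β ⊗ γ` -/
noncomputable def Δα : MT q :=
  tmul 1 (α q) (α q) (mem_right _ rfl) (mem_left _ rfl) +
    tmul (-1) (β q) (γ q) (mem_right _ rfl) (mem_left _ rfl)

/-- `Δ(β) = α ⊗ β + β ⊗ δ` -/
noncomputable def Δβ : MT q :=
  tmul 1 (α q) (β q) (mem_right _ rfl) (mem_left _ rfl) +
    tmul (-1) (β q) (δ q) (mem_right _ rfl) (mem_left _ rfl)

/-- `Δ(γ) = γ ⊗ α + δ ⊗ γ` -/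
noncomputable def Δγ : MT q :=
  tmul 1 (γ q) (α q) (mem_right _ rfl) (mem_left _ rfl) +
    tmul (-1) (δ q) (γ q) (mem_right _ rfl) (mem_left _ rfl)

/-- `Δ(δ) = γ ⊗ β + δ ⊗ δ` -/
noncomputable def Δδ : MT q :=
  tmul 1 (γ q) (β q) (mem_right _ rfl) (mem_left _ rfl) +
    tmul (-1) (δ q) (δ q) (mem_right _ rfl) (mem_left _ rfl)

/-- `Δ(f(λ)) = f(λ) ⊗ 1` -/
noncomputable def Δlam : Mer →ₐ[ℂ] MT q where
  toFun f := tmul 0 (lam q f) 1 (mem_right (.lam f) rfl) one_mem_leftDeg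
  map_one' := Subtype.ext (by
    change tm (lam q 1) 1 = tm 1 1
    rw [map_one])
  map_zero' := Subtype.ext (by
    change tm (lam q 0) 1 = 0
    rw [map_zero, tm, map_zero, TensorProduct.zero_tmul])
  map_add' f g := Subtype.ext (by
    change tm (lam q (f + g)) 1 = tm _ _ + tm _ _
    rw [map_add, add_tm])
  map_mul' f g := Subtype.ext (by
    change tm (lam q (f * g)) 1 = tm (lam q f * lam q g) (1 * 1)
    rw [map_mul, one_mul])
  commutes' z := Subtype.ext (by
    change tm (lam q (algebraMap ℂ Mer z)) 1 = z • tm 1 1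
    rw [AlgHom.commutes, Algebra.algebraMap_eq_smul_one, smul_tm])

/-- `Δ(f(μ)) = 1 ⊗ f(μ)` -/
noncomputable def Δmu : Mer →ₐ[ℂ] MT q where
  toFun f := tmul 0 1 (mu q f) one_mem_rightDeg (mem_left (.mu f) rfl)
  map_one' := Subtype.ext (by
    change tm 1 (mu q 1) = tm 1 1
    rw [map_one])
  map_zero' := Subtype.ext (by
    change tm 1 (mu q 0) = 0
    rw [map_zero, tm, map_zero, TensorProduct.tmul_zero])
  map_add' f g := Subtype.ext (by
    change tm 1 (mu q (f + g)) = tm _ _ + tm _ _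
    rw [map_add, tm_add])
  map_mul' f g := Subtype.ext (by
    change tm 1 (mu q (f * g)) = tm (1 * 1) (mu q f * mu q g)
    rw [map_mul, one_mul])
  commutes' z := Subtype.ext (by
    change tm 1 (mu q (algebraMap ℂ Mer z)) = z • tm 1 1
    rw [AlgHom.commutes, Algebra.algebraMap_eq_smul_one, tm_smul])

/-- The values of the coproduct on the generators. -/
noncomputable def ΔGen : Gen → MT q
  | .α => Δα q
  | .β => Δβ q
  | .γ => Δγ q
  | .δ => Δδ q
  | .lam f => Δlam q f
  | .mu f => Δmu q f

variable {q}

lemma coe_tmul (m : ℤ) (a b : FM q) (ha : a ∈ rightDeg q m) (hb : b ∈ leftDeg q m) :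
    ((tmul m a b ha hb : MT q) : TT q) = tm a b := rfl

lemma act_add_tmul (m n : ℤ) (a b a' b' c d : FM q) (ha : a ∈ rightDeg q m)
    (hb : b ∈ leftDeg q m) (ha' : a' ∈ rightDeg q n) (hb' : b' ∈ leftDeg q n) :
    act (tmul m a b ha hb + tmul n a' b' ha' hb') (tm c d) =
      tm (a * c) (b * d) + tm (a' * c) (b' * d) := by
  rw [act_add_left]; rfl

lemma coe_add_tmul (m n : ℤ) (a b a' b' : FM q) (ha : a ∈ rightDeg q m)
    (hb : b ∈ leftDeg q m) (ha' : a' ∈ rightDeg q n) (hb' : b' ∈ leftDeg q n) :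
    ((tmul m a b ha hb + tmul n a' b' ha' hb' : MT q) : TT q) = tm a b + tm a' b' := rfl

lemma act_Δlam (f : Mer) (c d : FM q) : act (Δlam q f) (tm c d) = tm (lam q f * c) d := by
  change tm (lam q f * c) (1 * d) = _
  rw [one_mul]

lemma act_Δmu (f : Mer) (c d : FM q) : act (Δmu q f) (tm c d) = tm c (mu q f * d) := by
  change tm (1 * c) (mu q f * d) = _
  rw [one_mul]

lemma coe_Δlam (f : Mer) : ((Δlam q f : MT q) : TT q) = tm (lam q f) 1 := rfl
lemma coe_Δmu (f : Mer) : ((Δmu q f : MT q) : TT q) = tm 1 (mu q f) := rfl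

lemma Δlam_Δmu (f g : Mer) : Δlam q f * Δmu q g = Δmu q g * Δlam q f := Subtype.ext (by
  rw [coe_mul, coe_mul, coe_Δmu, coe_Δlam, act_Δlam, act_Δmu, mul_one, mul_one])

/-- Compatibility of the coproduct with the dynamical relations. -/
lemma Δlam_mul (f : Mer) (m : ℤ) (a b a' b' : FM q) (ha : a ∈ rightDeg q 1)
    (hb : b ∈ leftDeg q 1) (ha' : a' ∈ rightDeg q (-1)) (hb' : b' ∈ leftDeg q (-1))
    (h : a ∈ leftDeg q m) (h' : a' ∈ leftDeg q m) :
    Δlam q f * (tmul 1 a b ha hb + tmul (-1) a' b' ha' hb') =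
      (tmul 1 a b ha hb + tmul (-1) a' b' ha' hb') * Δlam q (shift (m : ℂ) f) := Subtype.ext (by
  rw [coe_mul, coe_mul, coe_add_tmul, coe_Δlam, act_add_tmul, map_add, act_Δlam, act_Δlam,
    lam_mul_of_leftDeg h, lam_mul_of_leftDeg h', mul_one, mul_one])

lemma Δmu_mul (f : Mer) (m : ℤ) (a b a' b' : FM q) (ha : a ∈ rightDeg q 1)
    (hb : b ∈ leftDeg q 1) (ha' : a' ∈ rightDeg q (-1)) (hb' : b' ∈ leftDeg q (-1))
    (h : b ∈ rightDeg q m) (h' : b' ∈ rightDeg q m) :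
    Δmu q f * (tmul 1 a b ha hb + tmul (-1) a' b' ha' hb') =
      (tmul 1 a b ha hb + tmul (-1) a' b' ha' hb') * Δmu q (shift (m : ℂ) f) := Subtype.ext (by
  rw [coe_mul, coe_mul, coe_add_tmul, coe_Δmu, act_add_tmul, map_add, act_Δmu, act_Δmu,
    mu_mul_of_rightDeg h, mu_mul_of_rightDeg h', mul_one, mul_one])

lemma lam_mul_mu_mul (f g : Mer) (w : FM q) :
    lam q f * (mu q g * w) = mu q g * (lam q f * w) := by
  rw [← mul_assoc, commute_lam_mu, mul_assoc]

section

set_option linter.unusedSimpArgs false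

lemma Δα_Δβ : Δα q * Δβ q = q.val • (Δmu q (shift (-1) (fF q)) * (Δβ q * Δα q)) := by
  have hq := q.ne_zero
  rw [eq_smul_shift_fF_mul_iff]
  apply Subtype.ext
  simp only [Submodule.coe_smul, Submodule.coe_add, Submodule.coe_sub, coe_mul, Δα, Δβ, coe_tmul, map_add,
    map_sub, act_add_tmul, act_Δlam, act_Δmu]
  have h1 := congrArg (fun b => tm (α q * α q) b) (eq_βα (q := q))
  have h2 := congrArg (fun b => tm (β q * β q) b) (eq_δγ (q := q))
  have h3 := congrArg (fun a => tm a (δ q * α q)) (eq_βα (q := q))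
  have h4 := congrArg (fun a => tm a (γ q * β q)) (eq_βα (q := q))
  have h5 := congrArg (fun a => tm a (mu q (fP q) * (γ q * β q))) (eq_βα (q := q))
  have h6 := congrArg (fun b => tm (α q * β q) b) (eq_mid₁ (q := q))
  simp only [tm_add, tm_sub, tm_smul, add_tm, sub_tm, smul_tm, tm_mu, lam_mul_mu_mul] at h1 h2 h3 h4 h5 h6 ⊢
  linear_combination (norm := skip) h1 + h2 + h3 - q.val⁻¹ • h4 - (q.val⁻¹ * (1 - q.val ^ 2)) • h5 - h6
  match_scalars <;> field_simp <;> ring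

lemma Δγ_Δδ : Δγ q * Δδ q = q.val • (Δmu q (shift (-1) (fF q)) * (Δδ q * Δγ q)) := by
  have hq := q.ne_zero
  rw [eq_smul_shift_fF_mul_iff]
  apply Subtype.ext
  simp only [Submodule.coe_smul, Submodule.coe_add, Submodule.coe_sub, coe_mul, Δγ, Δδ, coe_tmul, map_add,
    map_sub, act_add_tmul, act_Δlam, act_Δmu]
  have h1 := congrArg (fun b => tm (γ q * γ q) b) (eq_βα (q := q))
  have h2 := congrArg (fun b => tm (δ q * δ q) b) (eq_δγ (q := q))
  have h3 := congrArg (fun a => tm a (δ q * α q)) (eq_δγ (q := q))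
  have h4 := congrArg (fun a => tm a (γ q * β q)) (eq_δγ (q := q))
  have h5 := congrArg (fun a => tm a (mu q (fP q) * (γ q * β q))) (eq_δγ (q := q))
  have h6 := congrArg (fun b => tm (γ q * δ q) b) (eq_mid₁ (q := q))
  simp only [tm_add, tm_sub, tm_smul, add_tm, sub_tm, smul_tm, tm_mu, lam_mul_mu_mul] at h1 h2 h3 h4 h5 h6 ⊢
  linear_combination (norm := skip) h1 + h2 + h3 - q.val⁻¹ • h4 - (q.val⁻¹ * (1 - q.val ^ 2)) • h5 - h6
  match_scalars <;> field_simp <;> ring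

lemma Δα_Δγ : Δα q * Δγ q = q.val • (Δlam q (fF q) * (Δγ q * Δα q)) := by
  have hq := q.ne_zero
  rw [map_fF]
  apply Subtype.ext
  simp only [Submodule.coe_smul, Submodule.coe_add, Submodule.coe_sub, coe_mul, Δα, Δγ, coe_tmul, map_add,
    map_sub, act_add_tmul, act_Δlam, act_Δmu]
  have h1 := congrArg (fun a => tm a (α q * α q)) (eq_αγ (q := q))
  have h2 := congrArg (fun a => tm a (γ q * γ q)) (eq_βδ (q := q))
  have h3 := congrArg (fun b => tm (α q * δ q) b) (eq_αγ (q := q))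
  have h4 := congrArg (fun b => tm (γ q * β q) b) (eq_αγ (q := q))
  have h5 := congrArg (fun b => tm (lam q (fP q) * (γ q * β q)) b) (eq_αγ (q := q))
  have h6 := congrArg (fun a => tm a (γ q * α q)) (eq_mid₂ (q := q))
  simp only [tm_add, tm_sub, tm_smul, add_tm, sub_tm, smul_tm, tm_mu, lam_mul_mu_mul] at h1 h2 h3 h4 h5 h6 ⊢
  linear_combination (norm := skip) h1 + h2 + h3 - q.val • h4 - (q.val * (1 - q.val⁻¹ ^ 2)) • h5 + h6
  match_scalars <;> field_simp <;> ring

lemma Δβ_Δδ : Δβ q * Δδ q = q.val • (Δlam q (fF q) * (Δδ q * Δβ q)) := by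
  have hq := q.ne_zero
  rw [map_fF]
  apply Subtype.ext
  simp only [Submodule.coe_smul, Submodule.coe_add, Submodule.coe_sub, coe_mul, Δβ, Δδ, coe_tmul, map_add,
    map_sub, act_add_tmul, act_Δlam, act_Δmu]
  have h1 := congrArg (fun a => tm a (β q * β q)) (eq_αγ (q := q))
  have h2 := congrArg (fun a => tm a (δ q * δ q)) (eq_βδ (q := q))
  have h3 := congrArg (fun b => tm (α q * δ q) b) (eq_βδ (q := q))
  have h4 := congrArg (fun b => tm (γ q * β q) b) (eq_βδ (q := q))
  have h5 := congrArg (fun b => tm (lam q (fP q) * (γ q * β q)) b) (eq_βδ (q := q))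
  have h6 := congrArg (fun a => tm a (δ q * β q)) (eq_mid₂ (q := q))
  simp only [tm_add, tm_sub, tm_smul, add_tm, sub_tm, smul_tm, tm_mu, lam_mul_mu_mul] at h1 h2 h3 h4 h5 h6 ⊢
  linear_combination (norm := skip) h1 + h2 + h3 - q.val • h4 - (q.val * (1 - q.val⁻¹ ^ 2)) • h5 + h6
  match_scalars <;> field_simp <;> ring

lemma Δcross₁ : Δα q * Δδ q - Δδ q * Δα q = fH q (Δlam q) (Δmu q) * (Δγ q * Δβ q) := by
  have hq := q.ne_zero
  rw [fH_eq q _ _ Δlam_Δmu, smul_mul_assoc, add_mul, add_mul, one_mul]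
  apply Subtype.ext
  simp only [Submodule.coe_smul, Submodule.coe_add, Submodule.coe_sub, coe_mul, Δα, Δβ, Δγ, Δδ, coe_tmul, map_add,
    map_sub, act_add_tmul, act_Δlam, act_Δmu]
  have h1 := congrArg (fun a => tm a (α q * β q)) (eq_αγ (q := q))
  have h2 := congrArg (fun b => tm (γ q * α q) b) (eq_βα (q := q))
  have h3 := congrArg (fun a => tm a (γ q * δ q)) (eq_βδ (q := q))
  have h4 := congrArg (fun b => tm (δ q * β q) b) (eq_δγ (q := q))
  have h5 := congrArg (fun a => tm a (α q * δ q)) (eq_αδ (q := q))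
  have h6 := congrArg (fun a => tm a (γ q * β q)) (eq_βγ (q := q))
  have h7 := congrArg (fun b => tm (γ q * β q) b) (eq_βγ' (q := q))
  have h8 := congrArg (fun b => tm (δ q * α q) b) (eq_αδ (q := q))
  simp only [tm_add, tm_sub, tm_smul, add_tm, sub_tm, smul_tm, tm_mu, lam_mul_mu_mul] at h1 h2 h3 h4 h5 h6 h7 h8 ⊢
  linear_combination (norm := skip) h1 - h2 + h3 - h4 + h5 + h6 - h7 + h8
  match_scalars <;> field_simp <;> ring

lemma Δcross₂ : Δβ q * Δγ q - Δmu q (fG q) * (Δγ q * Δβ q) = fI q (Δlam q) (Δmu q) * (Δδ q * Δα q) := by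
  have hq := q.ne_zero
  rw [fI_eq q _ _ Δlam_Δmu, smul_mul_assoc, sub_mul]
  apply Subtype.ext
  simp only [Submodule.coe_smul, Submodule.coe_add, Submodule.coe_sub, coe_mul, Δα, Δβ, Δγ, Δδ, coe_tmul, map_add,
    map_sub, act_add_tmul, act_Δlam, act_Δmu]
  have h1 := congrArg (fun a => tm a (β q * α q)) (eq_αγ (q := q))
  have h2 := congrArg (fun b => tm (γ q * α q) b) (eq_G_αβ (q := q))
  have h3 := congrArg (fun a => tm a (δ q * γ q)) (eq_βδ (q := q))
  have h4 := congrArg (fun b => tm (δ q * β q) b) (eq_G_γδ (q := q))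
  have h5 := congrArg (fun a => tm a (β q * γ q)) (eq_αδ (q := q))
  have h6 := congrArg (fun a => tm a (δ q * α q)) (eq_βγ (q := q))
  have h7 := congrArg (fun b => tm (γ q * β q) b) (eq_G_αδ (q := q))
  have h8 := congrArg (fun b => tm (δ q * α q) b) (eq_βγ (q := q))
  simp only [tm_add, tm_sub, tm_smul, add_tm, sub_tm, smul_tm, tm_mu, lam_mul_mu_mul] at h1 h2 h3 h4 h5 h6 h7 h8 ⊢
  linear_combination (norm := skip) h1 - h2 + h3 - h4 + h5 + h6 - h7 + h8
  match_scalars <;> field_simp <;> ring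

end

end FM

namespace FM

variable (q : QParam)

lemma ΔGen_rel {x y : FreeAlgebra ℂ Gen} (h : Rel q x y) :
    FreeAlgebra.lift ℂ (ΔGen q) x = FreeAlgebra.lift ℂ (ΔGen q) y := by
  cases h with
  | lam_const z => simp [ΔGen]
  | lam_add f g => simp [ΔGen]
  | lam_mul f g => simp [ΔGen]
  | mu_const z => simp [ΔGen]
  | mu_add f g => simp [ΔGen]
  | mu_mul f g => simp [ΔGen]
  | lam_mu f g => simpa [ΔGen] using Δlam_Δmu f g
  | lam_α f =>
    have h : Δlam q f * Δα q = Δα q * Δlam q (shift ((1 : ℤ) : ℂ) f) :=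
      Δlam_mul f 1 _ _ _ _ _ _ _ _ (mem_left .α rfl) (mem_left .β rfl)
    simpa [ΔGen] using h
  | mu_α f =>
    have h : Δmu q f * Δα q = Δα q * Δmu q (shift ((1 : ℤ) : ℂ) f) :=
      Δmu_mul f 1 _ _ _ _ _ _ _ _ (mem_right .α rfl) (mem_right .γ rfl)
    simpa [ΔGen] using h
  | lam_β f =>
    have h : Δlam q f * Δβ q = Δβ q * Δlam q (shift ((1 : ℤ) : ℂ) f) :=
      Δlam_mul f 1 _ _ _ _ _ _ _ _ (mem_left .α rfl) (mem_left .β rfl)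
    simpa [ΔGen] using h
  | mu_β f =>
    have h : Δmu q f * Δβ q = Δβ q * Δmu q (shift ((-1 : ℤ) : ℂ) f) :=
      Δmu_mul f (-1) _ _ _ _ _ _ _ _ (mem_right .β rfl) (mem_right .δ rfl)
    simpa [ΔGen] using h
  | lam_γ f =>
    have h : Δlam q f * Δγ q = Δγ q * Δlam q (shift ((-1 : ℤ) : ℂ) f) :=
      Δlam_mul f (-1) _ _ _ _ _ _ _ _ (mem_left .γ rfl) (mem_left .δ rfl)
    simpa [ΔGen] using h
  | mu_γ f =>
    have h : Δmu q f * Δγ q = Δγ q * Δmu q (shift ((1 : ℤ) : ℂ) f) :=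
      Δmu_mul f 1 _ _ _ _ _ _ _ _ (mem_right .α rfl) (mem_right .γ rfl)
    simpa [ΔGen] using h
  | lam_δ f =>
    have h : Δlam q f * Δδ q = Δδ q * Δlam q (shift ((-1 : ℤ) : ℂ) f) :=
      Δlam_mul f (-1) _ _ _ _ _ _ _ _ (mem_left .γ rfl) (mem_left .δ rfl)
    simpa [ΔGen] using h
  | mu_δ f =>
    have h : Δmu q f * Δδ q = Δδ q * Δmu q (shift ((-1 : ℤ) : ℂ) f) :=
      Δmu_mul f (-1) _ _ _ _ _ _ _ _ (mem_right .β rfl) (mem_right .δ rfl)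
    simpa [ΔGen] using h
  | αβ => simpa only [map_mul, map_smul, FreeAlgebra.lift_ι_apply, ΔGen] using Δα_Δβ (q := q)
  | αγ => simpa only [map_mul, map_smul, FreeAlgebra.lift_ι_apply, ΔGen] using Δα_Δγ (q := q)
  | βδ => simpa only [map_mul, map_smul, FreeAlgebra.lift_ι_apply, ΔGen] using Δβ_Δδ (q := q)
  | γδ => simpa only [map_mul, map_smul, FreeAlgebra.lift_ι_apply, ΔGen] using Δγ_Δδ (q := q)
  | cross₁ =>
    simpa only [map_mul, map_sub, map_fH, FreeAlgebra.lift_ι_apply, ΔGen] using Δcross₁ (q := q)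
  | cross₂ =>
    simpa only [map_mul, map_sub, map_fI, FreeAlgebra.lift_ι_apply, ΔGen] using Δcross₂ (q := q)

/-- The coproduct of `F_R(M(2))`. -/
noncomputable def Δ : FM q →ₐ[ℂ] MT q :=
  RingQuot.liftAlgHom ℂ ⟨FreeAlgebra.lift ℂ (ΔGen q), fun _ _ h => ΔGen_rel q h⟩

lemma Δ_gen (g : Gen) : Δ q (gen q g) = ΔGen q g := by
  have : Δ q (gen q g) = FreeAlgebra.lift ℂ (ΔGen q) (FreeAlgebra.ι ℂ g) :=
    RingQuot.liftAlgHom_mkAlgHom_apply ℂ _ _ _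
  rw [this, FreeAlgebra.lift_ι_apply]

/-! ### The corepresentation spaces `V_N` -/

/-- The space `V_N`, spanned over the meromorphic functions (through the left moment map) by the
elements `γ^(N-k) α^k`, `0 ≤ k ≤ N`, of `F_R(M(2))`. -/
noncomputable def V (N : ℕ) : Submodule Mer (Via (lam q)) :=
  Submodule.span Mer
    (Set.range fun k : Fin (N + 1) => Via.of (lam q) (γ q ^ (N - (k : ℕ)) * α q ^ (k : ℕ)))

/-- The grading of `V_N`, which is induced by the left degree. -/
noncomputable def grV (N : ℕ) (n : ℤ) : Submodule ℂ (V q N) :=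
  (leftGr q n).comap ((V q N).subtype.restrictScalars ℂ)

variable {q}

lemma coe_pow_mem {N k : ℕ} (hk : k ≤ N) : Via.of (lam q) (γ q ^ (N - k) * α q ^ k) ∈ V q N :=
  Submodule.subset_span ⟨⟨k, Nat.lt_succ_of_le hk⟩, rfl⟩

lemma V_le {N : ℕ} {p : Submodule Mer (Via (lam q))}
    (h : ∀ k ≤ N, Via.of (lam q) (γ q ^ (N - k) * α q ^ k) ∈ p) : V q N ≤ p := by
  refine Submodule.span_le.2 ?_
  rintro _ ⟨k, rfl⟩
  exact h k (Nat.lt_succ_iff.1 k.2)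

/-- Multiplication from the left by an element of `A_{m•}` maps `V_N` to the space spanned by the
products with the generators of `V_N`. -/
lemma mul_mem_of_gen {N : ℕ} {m : ℤ} {a : FM q} (ha : a ∈ leftDeg q m)
    {p : Submodule Mer (Via (lam q))}
    (h : ∀ k ≤ N, Via.of (lam q) (a * (γ q ^ (N - k) * α q ^ k)) ∈ p) {v : FM q}
    (hv : Via.of (lam q) v ∈ V q N) : Via.of (lam q) (a * v) ∈ p := by
  let p' : Submodule Mer (Via (lam q)) :=
    { carrier := {x | Via.of (lam q) (a * (Via.of (lam q)).symm x) ∈ p}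
      add_mem' := fun {x y} hx hy => by
        have := p.add_mem hx hy
        rwa [← map_add, ← mul_add, ← map_add] at this
      zero_mem' := by
        change Via.of (lam q) (a * (Via.of (lam q)).symm 0) ∈ p
        rw [map_zero, mul_zero, map_zero]; exact p.zero_mem
      smul_mem' := fun f x hx => by
        have h1 := lam_mul_of_leftDeg ha (shift (-(m : ℂ)) f)
        rw [shift_shift, add_neg_cancel, shift_zero] at h1
        obtain ⟨b, rfl⟩ := (Via.of (lam q)).surjective x
        have := p.smul_mem (shift (-(m : ℂ)) f) hx
        change Via.of (lam q) (a * (lam q f * b)) ∈ p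
        rw [← mul_assoc, ← h1, mul_assoc]
        exact this }
  exact V_le (p := p') h hv

lemma mul_γ_mem {N : ℕ} {v : FM q} (hv : Via.of (lam q) v ∈ V q N) :
    Via.of (lam q) (γ q * v) ∈ V q (N + 1) := by
  refine mul_mem_of_gen (mem_left .γ rfl) (fun k hk => ?_) hv
  have := coe_pow_mem (q := q) (N := N + 1) (k := k) (by omega)
  rwa [Nat.sub_add_comm hk, pow_succ', mul_assoc] at this

lemma α_mul_γ_pow (m : ℕ) : ∃ f : Mer, α q * γ q ^ m = lam q f * (γ q ^ m * α q) := by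
  induction m with
  | zero => exact ⟨1, by simp⟩
  | succ m ih =>
    obtain ⟨f, hf⟩ := ih
    have hm : γ q ^ m ∈ leftDeg q (-(m : ℤ)) := by
      clear hf
      induction m with
      | zero => simpa using one_mem_leftDeg
      | succ m ih =>
        rw [pow_succ]
        have := mul_mem_leftDeg ih (mem_left (q := q) .γ (n := -1) rfl)
        convert this using 1
        push_cast; ring_nf
    have h1 := lam_mul_of_leftDeg hm (shift (((m : ℕ) : ℂ)) (cst q.val * fF q))
    push_cast at h1
    rw [shift_shift, neg_add_cancel, shift_zero] at h1
    have h2 : α q * γ q = lam q (cst q.val * fF q) * (γ q * α q) := by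
      rw [rel_αγ, map_mul, (lam q).commutes, ← Algebra.smul_def, smul_mul_assoc]
    refine ⟨f * shift ((m : ℕ) : ℂ) (cst q.val * fF q), ?_⟩
    rw [pow_succ, ← mul_assoc, hf, mul_assoc, mul_assoc, h2, ← mul_assoc (γ q ^ m), ← h1, map_mul (lam q) f]
    simp only [mul_assoc]

lemma mul_α_mem {N : ℕ} {v : FM q} (hv : Via.of (lam q) v ∈ V q N) :
    Via.of (lam q) (α q * v) ∈ V q (N + 1) := by
  refine mul_mem_of_gen (mem_left .α rfl) (fun k hk => ?_) hv
  obtain ⟨f, hf⟩ := α_mul_γ_pow (q := q) (N - k)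
  have := coe_pow_mem (q := q) (N := N + 1) (k := k + 1) (by omega)
  rw [Nat.add_sub_add_right, pow_succ', ← mul_assoc] at this
  have h := (V q (N + 1)).smul_mem f this
  rw [Via.smul_of] at h
  rw [← mul_assoc, hf]
  simpa only [mul_assoc] using h

variable (q) in
/-- The image of `A ⊗̃ V_N` in `A ⊗ A`. -/
noncomputable def W (N : ℕ) : Submodule ℂ (TT q) :=
  Submodule.span ℂ {x | ∃ n : ℤ, ∃ a ∈ rightDeg q n, ∃ b ∈ leftDeg q n,
    Via.of (lam q) b ∈ V q N ∧ tm a b = x}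

lemma tm_mem_W {N : ℕ} {n : ℤ} {a b : FM q} (ha : a ∈ rightDeg q n) (hb : b ∈ leftDeg q n)
    (h : Via.of (lam q) b ∈ V q N) : tm a b ∈ W q N :=
  Submodule.subset_span ⟨n, a, ha, b, hb, h, rfl⟩

lemma act_mem_W {N N' : ℕ} {x : MT q} (h : ∀ (n : ℤ) (a b : FM q), a ∈ rightDeg q n →
    b ∈ leftDeg q n → Via.of (lam q) b ∈ V q N → act x (tm a b) ∈ W q N') {y : TT q}
    (hy : y ∈ W q N) : act x y ∈ W q N' := by
  refine Submodule.span_induction (p := fun y _ => act x y ∈ W q N') ?_ ?_ ?_ ?_ hy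
  · rintro _ ⟨n, a, ha, b, hb, hv, rfl⟩
    exact h n a b ha hb hv
  · rw [map_zero]; exact Submodule.zero_mem _
  · intro y z _ _ hy hz
    rw [map_add]; exact Submodule.add_mem _ hy hz
  · intro w y _ hy
    rw [act_smul]; exact Submodule.smul_mem _ _ hy

lemma act_Δα_mem_W {N : ℕ} {y : TT q} (hy : y ∈ W q N) : act (Δα q) y ∈ W q (N + 1) := by
  refine act_mem_W (fun n a b ha hb hv => ?_) hy
  rw [Δα, act_add_tmul]
  exact Submodule.add_mem _
    (tm_mem_W (mul_mem_rightDeg (mem_right _ rfl) ha) (mul_mem_leftDeg (mem_left .α rfl) hb)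
      (mul_α_mem hv))
    (tm_mem_W (mul_mem_rightDeg (mem_right _ rfl) ha) (mul_mem_leftDeg (mem_left .γ rfl) hb)
      (mul_γ_mem hv))

lemma act_Δγ_mem_W {N : ℕ} {y : TT q} (hy : y ∈ W q N) : act (Δγ q) y ∈ W q (N + 1) := by
  refine act_mem_W (fun n a b ha hb hv => ?_) hy
  rw [Δγ, act_add_tmul]
  exact Submodule.add_mem _
    (tm_mem_W (mul_mem_rightDeg (mem_right _ rfl) ha) (mul_mem_leftDeg (mem_left .α rfl) hb)
      (mul_α_mem hv))
    (tm_mem_W (mul_mem_rightDeg (mem_right _ rfl) ha) (mul_mem_leftDeg (mem_left .γ rfl) hb)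
      (mul_γ_mem hv))

lemma act_Δlam_mem_W {N : ℕ} (f : Mer) {y : TT q} (hy : y ∈ W q N) :
    act (Δlam q f) y ∈ W q N := by
  refine act_mem_W (fun n a b ha hb hv => ?_) hy
  rw [act_Δlam]
  refine tm_mem_W ?_ hb hv
  have := mul_mem_rightDeg (mem_right (q := q) (.lam f) (n := 0) rfl) ha
  rwa [zero_add] at this

lemma one_mem_V : Via.of (lam q) 1 ∈ V q 0 := by
  simpa using coe_pow_mem (q := q) (N := 0) (k := 0) le_rfl

lemma Δ_α_pow_mem_W (k : ℕ) : (Δ q (α q ^ k) : TT q) ∈ W q k := by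
  induction k with
  | zero =>
    rw [pow_zero, map_one, coe_one]
    exact tm_mem_W one_mem_rightDeg one_mem_leftDeg one_mem_V
  | succ k ih =>
    rw [pow_succ', map_mul, Δ_gen, coe_mul]
    exact act_Δα_mem_W ih

lemma Δ_γ_pow_mem_W (j k : ℕ) : (Δ q (γ q ^ j * α q ^ k) : TT q) ∈ W q (j + k) := by
  induction j with
  | zero => rw [pow_zero, one_mul, zero_add]; exact Δ_α_pow_mem_W k
  | succ j ih =>
    rw [pow_succ', mul_assoc, map_mul, Δ_gen, coe_mul, Nat.add_right_comm]
    exact act_Δγ_mem_W ih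

/-- `Δ(V_N) ⊆ A ⊗̃ V_N`. -/
lemma Δ_mem_W {N : ℕ} {v : FM q} (hv : Via.of (lam q) v ∈ V q N) : (Δ q v : TT q) ∈ W q N := by
  let p : Submodule Mer (Via (lam q)) :=
    { carrier := {x | (Δ q ((Via.of (lam q)).symm x) : TT q) ∈ W q N}
      add_mem' := fun {x y} hx hy => by
        have := (W q N).add_mem hx hy
        rwa [← Submodule.coe_add, ← map_add, ← map_add] at this
      zero_mem' := by
        change (Δ q ((Via.of (lam q)).symm 0) : TT q) ∈ W q N
        rw [map_zero, map_zero]; exact (W q N).zero_mem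
      smul_mem' := fun f x hx => by
        obtain ⟨b, rfl⟩ := (Via.of (lam q)).surjective x
        change (Δ q (lam q f * b) : TT q) ∈ W q N
        rw [map_mul, ← gen_lam, Δ_gen, coe_mul]
        exact act_Δlam_mem_W f hx }
  refine V_le (p := p) (fun k hk => ?_) hv
  have := Δ_γ_pow_mem_W (q := q) (N - k) k
  rwa [Nat.sub_add_cancel hk] at this

variable (q)

/-- The tensor product `A ⊗̃ V_N`, where `A = F_R(M(2))`. -/
noncomputable def MTV (N : ℕ) : Submodule ℂ (Via (mu q) ⊗[Mer] V q N) :=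
  matTensor (mu q) (rightDeg q) (grV q N)

/-- The embedding `A ⊗ V_N → A ⊗ A`. -/
noncomputable def incl (N : ℕ) : Via (mu q) ⊗[Mer] V q N →ₗ[Mer] TT q :=
  (V q N).subtype.lTensor (Via (mu q))

lemma incl_injective (N : ℕ) : Function.Injective (incl q N) :=
  Module.Flat.lTensor_preserves_injective_linearMap _ (V q N).injective_subtype

/-- The embedding `A ⊗̃ V_N → A ⊗ A`. -/
noncomputable def inclMTV (N : ℕ) : MTV q N →ₗ[ℂ] TT q :=
  ((incl q N).restrictScalars ℂ).domRestrict (MTV q N)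

lemma inclMTV_injective (N : ℕ) : Function.Injective (inclMTV q N) :=
  fun _ _ h => Subtype.ext (incl_injective q N h)

/-- The restriction of the coproduct to `V_N`, with values in `A ⊗ A`. -/
noncomputable def ΔV (N : ℕ) : V q N →ₗ[ℂ] TT q :=
  (MT q).subtype ∘ₗ (Δ q).toLinearMap ∘ₗ (Via.of (lam q)).symm.toLinearMap ∘ₗ
    (V q N).subtype.restrictScalars ℂ

lemma ΔV_mem_range (N : ℕ) (v : V q N) : ΔV q N v ∈ LinearMap.range (inclMTV q N) := by
  have h : ΔV q N v ∈ W q N :=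
    Δ_mem_W (v := (Via.of (lam q)).symm v) v.2
  have hle : W q N ≤ LinearMap.range (inclMTV q N) := by
    refine Submodule.span_le.2 ?_
    rintro _ ⟨n, a, ha, b, hb, hv, rfl⟩
    exact ⟨⟨Via.of (mu q) a ⊗ₜ[Mer] (⟨Via.of (lam q) b, hv⟩ : V q N),
      Submodule.subset_span ⟨n, a, ha, _, Submodule.mem_map_of_mem hb, rfl⟩⟩, rfl⟩
  exact hle h

/-- The restriction of the coproduct to `V_N`, as a map `V_N → A ⊗̃ V_N`, where
`A = F_R(M(2))`. -/
noncomputable def coactionM (N : ℕ) : V q N →ₗ[ℂ] MTV q N :=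
  (LinearEquiv.ofInjective (inclMTV q N) (inclMTV_injective q N)).symm.toLinearMap ∘ₗ
    (ΔV q N).codRestrict _ (ΔV_mem_range q N)

lemma incl_coactionM (N : ℕ) (v : V q N) :
    incl q N (coactionM q N v) = (Δ q ((Via.of (lam q)).symm v) : TT q) := by
  have := LinearEquiv.apply_symm_apply (LinearEquiv.ofInjective (inclMTV q N)
    (inclMTV_injective q N)) ((ΔV q N).codRestrict _ (ΔV_mem_range q N) v)
  exact congrArg Subtype.val this

end FM

/-! ### The algebra `F_R(SL(2))` and its corepresentations -/

/-- The relation `c = 1`, where `c = αδ - q F(λ) γβ` is the determinant. -/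
inductive DetRel (q : QParam) : FM q → FM q → Prop
  | det : DetRel q
      (FM.α q * FM.δ q - q.val • (FM.lam q (fF q) * (FM.γ q * FM.β q))) 1

/-- The algebra `F_R(SL(2))`. -/
def FSL (q : QParam) : Type := RingQuot (DetRel q)

noncomputable instance (q : QParam) : Ring (FSL q) := inferInstanceAs (Ring (RingQuot (DetRel q)))
noncomputable instance (q : QParam) : Algebra ℂ (FSL q) :=
  inferInstanceAs (Algebra ℂ (RingQuot (DetRel q)))

namespace FSL

variable (q : QParam)

/-- The quotient map `F_R(M(2)) → F_R(SL(2))`. -/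
noncomputable def proj : FM q →ₐ[ℂ] FSL q := RingQuot.mkAlgHom ℂ (DetRel q)

/-- The right moment map `f ↦ f(μ)`. -/
noncomputable def mu : Mer →ₐ[ℂ] FSL q := (proj q).comp (FM.mu q)

/-- `A_{• n} = ⨁ₘ A_{mn}`, for the bigrading of `A = F_R(SL(2))` induced from that of
`F_R(M(2))`. -/
noncomputable def rightDeg (n : ℤ) : Submodule ℂ (FSL q) :=
  (FM.rightDeg q n).map (proj q).toLinearMap

/-- The quotient map is linear over the meromorphic functions. -/
noncomputable def projVia : Via (FM.mu q) →ₗ[Mer] Via (mu q) where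
  toFun x := Via.of (mu q) (proj q ((Via.of (FM.mu q)).symm x))
  map_add' x y := by simp only [map_add]
  map_smul' f x := by
    obtain ⟨a, rfl⟩ := (Via.of (FM.mu q)).surjective x
    simp only [Via.smul_of, LinearEquiv.symm_apply_apply, RingHom.id_apply, map_mul]
    rfl

/-- The tensor product `A ⊗̃ V_N`, where `A = F_R(SL(2))`. -/
noncomputable def SLTV (N : ℕ) : Submodule ℂ (Via (mu q) ⊗[Mer] FM.V q N) :=
  matTensor (mu q) (rightDeg q) (FM.grV q N)

lemma rTensor_projVia_mem {N : ℕ} {x : Via (FM.mu q) ⊗[Mer] FM.V q N} (hx : x ∈ FM.MTV q N) :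
    (projVia q).rTensor (FM.V q N) x ∈ SLTV q N := by
  have : FM.MTV q N ≤
      (SLTV q N).comap (((projVia q).rTensor (FM.V q N)).restrictScalars ℂ) := by
    refine Submodule.span_le.2 ?_
    rintro _ ⟨n, a, ha, v, hv, rfl⟩
    exact Submodule.subset_span ⟨n, proj q a, Submodule.mem_map_of_mem ha, v, hv, rfl⟩
  exact this hx

/-- The coaction `π_N : V_N → A ⊗̃ V_N` of `A = F_R(SL(2))` on `V_N`, obtained from the coproduct
of `F_R(M(2))` by passing to the quotient in the first factor. -/
noncomputable def coaction (N : ℕ) : FM.V q N →ₗ[ℂ] SLTV q N :=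
  (((projVia q).rTensor (FM.V q N)).restrictScalars ℂ).restrict
    (fun _ hx => rTensor_projVia_mem q hx) ∘ₗ FM.coactionM q N

variable {q}

/-- An intertwiner `V_M → V_N` of corepresentations of `F_R(SL(2))`: a map that is linear over the
meromorphic functions, preserves the grading, and satisfies `π_N ∘ φ = (id ⊗ φ) ∘ π_M`. -/
structure IsIntertwiner {M N : ℕ} (φ : FM.V q M →ₗ[Mer] FM.V q N) : Prop where
  map_gr : ∀ (n : ℤ) (v : FM.V q M), v ∈ FM.grV q M n → φ v ∈ FM.grV q N n
  coaction_map : ∀ v : FM.V q M,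
    (coaction q N (φ v) : Via (mu q) ⊗[Mer] FM.V q N) = φ.lTensor (Via (mu q)) (coaction q M v)

end FSL

end DynSL2

namespace DynSL2

/-! ### Meromorphic functions -/

/-! Let `e_k = γ^(N-k) α^k` be the basis of `V_N`, let `t^N` be the matrix of `π_N` in it, and let
`φ_ik` be the `i`-th coordinate of `φ(e_k)`. The intertwining property becomes `∑ φ_ik(λ) t^N_ij = ∑
φ_ji(μ) t^M_ki` in `F_R(SL(2))` (`FSL.IsIntertwiner.sum_eq`), and the grading permits `φ_ik ≠ 0`
only if `2i - N = 2k - M`. In the column `j = N` the entries `t^N_iN` are the monomials `γ^(N-i)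
α^i`, and each side has at most one nonzero term.

If `M = N`, this reads `φ_kk(λ) γ^(N-k) α^k = φ_NN(μ) γ^(N-k) α^k`. After cancelling the monomial, a
function of `λ` equals a function of `μ`, so both are one and the same constant.

If `M ≠ N`, a possibly nonzero entry `φ_Nk` satisfies `φ_Nk(μ) t^M_Mk = 0`, because the grading
kills the other side. Here `t^M_Mk` is a function of `μ` times `β^(M-k) α^k`, and that function is
nonzero because it is positive at large real arguments (`FM.exists_coeff_zero_eq`). So the last row
of `φ` vanishes, and the column `j = N` then forces `φ = 0`.

The cancellations require that the quotient algebra be large enough. This is shown by an explicit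
representation on `Mer ⊗ Mer`, with the functions acting by multiplication and the four generators
by translations with multipliers. There `γ^i α^j` sends `1` to a unit, and `β^i α^j` sends `1` to an
element that is nonzero on suitable lines. -/

lemma meromorphic_qpow_half (q : QParam) : Meromorphic fun l : ℂ => q.val ^ (l + 1) := by
  intro x
  apply AnalyticAt.meromorphicAt
  have : (fun l : ℂ => q.val ^ (l + 1)) = fun l => Complex.exp (Complex.log q.val * (l + 1)) := by
    funext l; rw [Complex.cpow_def_of_ne_zero q.ne_zero]
  rw [this]
  fun_prop

/-- The meromorphic function `λ ↦ q ^ (λ+1)`. -/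
noncomputable def fu (q : QParam) : Mer :=
  Mer.mk (fun l => q.val ^ (l + 1)) (meromorphic_qpow_half q)

/-- The square root is needed because a unit translation multiplies it by `q` instead of `q²`; this
supplies the odd powers of `q` in the relations `αγ = qF(λ)γα` and `αβ = qF(μ-1)βα`. -/
lemma fu_mul_fu (q : QParam) : fu q * fu q = fQ q := by
  change Mer.mk (fun l => q.val ^ (l + 1) * q.val ^ (l + 1)) _ = Mer.mk _ _
  congr 1
  funext l
  rw [← Complex.cpow_add _ _ q.ne_zero, two_mul]

lemma fu_ne_zero (q : QParam) : fu q ≠ 0 :=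
  left_ne_zero_of_mul (fu_mul_fu q ▸ fQ_ne_zero q)

lemma shift_fu (q : QParam) (a : ℂ) : shift a (fu q) = cst (q.val ^ a) * fu q := by
  rw [fu, shift_mk]
  change _ = Mer.mk (fun l => q.val ^ a * q.val ^ (l + 1)) _
  congr 1
  funext l
  rw [← Complex.cpow_add _ _ q.ne_zero]
  congr 1; ring

lemma shift_one_fu (q : QParam) : shift 1 (fu q) = cst q.val * fu q := by
  rw [shift_fu, Complex.cpow_one]

lemma shift_neg_one_fu (q : QParam) : shift (-1) (fu q) = cst q.val⁻¹ * fu q := by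
  rw [shift_fu, Complex.cpow_neg_one]

lemma shift_intCast_fQ (q : QParam) (n : ℤ) :
    shift (n : ℂ) (fQ q) = cst (q.val ^ (2 * n)) * fQ q := by
  rw [← fu_mul_fu, map_mul, shift_fu, Complex.cpow_intCast, two_mul,
    zpow_add₀ q.ne_zero, cst_mul]
  ring

lemma shift_one_fQ (q : QParam) : shift 1 (fQ q) = cst q.val ^ 2 * fQ q := by
  rw [← fu_mul_fu, map_mul, shift_one_fu]; ring

lemma shift_neg_one_fQ (q : QParam) : shift (-1) (fQ q) = cst q.val⁻¹ ^ 2 * fQ q := by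
  rw [← fu_mul_fu, map_mul, shift_neg_one_fu]; ring

lemma shift_fP_mul (q : QParam) (a : ℂ) : shift a (fP q) * (shift a (fQ q) - 1) = 1 := by
  have h := congrArg (shift a) (inv_mul_cancel₀ (fQ_sub_one_ne q))
  rwa [map_mul, map_sub, map_one] at h

lemma fF_eq_mul_fP (q : QParam) : fF q = (fQ q - cst q.val⁻¹ ^ 2) * fP q := by
  rw [fF, fP, div_eq_mul_inv, cst, map_pow]

lemma fG_eq_mul_fP (q : QParam) :
    fG q = (fQ q - cst q.val ^ 2) * (fQ q - cst q.val⁻¹ ^ 2) * fP q ^ 2 := by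
  rw [fG, fP, div_eq_mul_inv, cst, cst, map_pow, map_pow, inv_pow]

/-! ### Positivity at large real arguments. -/

/-- Meromorphic functions that take positive values at all large real numbers. -/
def EventuallyPos (f : Mer) : Prop :=
  ∃ (g : ℂ → ℂ) (hg : Meromorphic g), f = Mer.mk g hg ∧
    ∃ x₀ : ℝ, ∀ x : ℝ, x₀ ≤ x → ∃ r : ℝ, 0 < r ∧ g x = r

namespace EventuallyPos

/-- A representative of `0` vanishes throughout a punctured neighbourhood of each point, in
particular of `x₀`, and such a neighbourhood meets the half-line on which the values are positive.
-/
lemma ne_zero {f : Mer} (hf : EventuallyPos f) : f ≠ 0 := by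
  obtain ⟨g, hg, rfl, x₀, hx⟩ := hf
  intro h
  have h2 : ∀ᶠ x in Filter.codiscrete ℂ, g x = 0 := Ideal.Quotient.eq_zero_iff_mem.1 h
  rw [Filter.codiscrete, Filter.Eventually, mem_codiscreteWithin_iff_forall_mem_nhdsNE] at h2
  have h3 := h2 x₀ trivial
  rw [Set.compl_univ, Set.union_empty, Metric.mem_nhdsWithin_iff] at h3
  obtain ⟨ε, hε, h4⟩ := h3
  obtain ⟨r, hr, h5⟩ := hx (x₀ + ε / 2) (by linarith)
  have h6 : ((x₀ + ε / 2 : ℝ) : ℂ) ∈ {x | g x = 0} := by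
    apply h4
    constructor
    · rw [Metric.mem_ball, Complex.dist_eq, ← Complex.ofReal_sub, Complex.norm_real,
        add_sub_cancel_left, Real.norm_of_nonneg (by linarith)]
      linarith
    · simp [hε.ne']
  have h7 : g ((x₀ + ε / 2 : ℝ) : ℂ) = 0 := h6
  rw [h5, Complex.ofReal_eq_zero] at h7
  exact hr.ne' h7

lemma mul {f g : Mer} (hf : EventuallyPos f) (hg : EventuallyPos g) : EventuallyPos (f * g) := by
  obtain ⟨f, hf, rfl, x₀, hx⟩ := hf
  obtain ⟨g, hg, rfl, y₀, hy⟩ := hg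
  refine ⟨f * g, hf.mul hg, rfl, max x₀ y₀, fun x h => ?_⟩
  obtain ⟨r, hr, h1⟩ := hx x ((le_max_left _ _).trans h)
  obtain ⟨s, hs, h2⟩ := hy x ((le_max_right _ _).trans h)
  exact ⟨r * s, mul_pos hr hs, by simp [h1, h2]⟩

lemma add {f g : Mer} (hf : EventuallyPos f) (hg : EventuallyPos g) : EventuallyPos (f + g) := by
  obtain ⟨f, hf, rfl, x₀, hx⟩ := hf
  obtain ⟨g, hg, rfl, y₀, hy⟩ := hg
  refine ⟨f + g, hf.add hg, rfl, max x₀ y₀, fun x h => ?_⟩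
  obtain ⟨r, hr, h1⟩ := hx x ((le_max_left _ _).trans h)
  obtain ⟨s, hs, h2⟩ := hy x ((le_max_right _ _).trans h)
  exact ⟨r + s, add_pos hr hs, by simp [h1, h2]⟩

lemma inv {f : Mer} (hf : EventuallyPos f) : EventuallyPos f⁻¹ := by
  have h0 := hf.ne_zero
  obtain ⟨g, hg, rfl, x₀, hx⟩ := hf
  refine ⟨g⁻¹, hg.inv, ?_, x₀, fun x h => ?_⟩
  -- Pointwise, `g * g⁻¹ = 1` fails at the zeros of `g`, whereas `g * g * g⁻¹ = g` holds everywhere.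
  -- The latter is therefore an identity of representatives, and one factor is cancelled in the
  -- field.
  · refine inv_eq_of_mul_eq_one_right (mul_left_cancel₀ h0 ?_)
    rw [mul_one, ← mul_assoc]
    change Mer.mk (fun x => g x * g x * (g x)⁻¹) _ = _
    congr 1
    funext x
    exact mul_self_mul_inv (g x)
  · obtain ⟨r, hr, h1⟩ := hx x h
    exact ⟨r⁻¹, inv_pos.2 hr, by simp [h1]⟩

lemma shift {f : Mer} (hf : EventuallyPos f) (a : ℝ) : EventuallyPos (shift a f) := by
  obtain ⟨g, hg, rfl, x₀, hx⟩ := hf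
  refine ⟨_, _, shift_mk a g hg, x₀ - a, fun x h => ?_⟩
  obtain ⟨r, hr, h1⟩ := hx (x + a) (by linarith)
  exact ⟨r, hr, by simpa using h1⟩

lemma cst {r : ℝ} (hr : 0 < r) : EventuallyPos (cst r) :=
  ⟨fun _ => r, .const (𝕜 := ℂ) _, rfl, 0, fun _ _ => ⟨r, hr, rfl⟩⟩

lemma one : EventuallyPos 1 := by
  simpa using cst one_pos

/-- For real `x ≥ 0` one has `q^(2(x+1)) < 1 ≤ r`. -/
lemma cst_sub_fQ (q : QParam) {r : ℝ} (hr : 1 ≤ r) : EventuallyPos (DynSL2.cst r - fQ q) := by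
  refine ⟨fun x => r - q.val ^ (2 * (x + 1)),
    (Meromorphic.const (𝕜 := ℂ) _).sub (meromorphic_qpow q), rfl, 0,
    fun x hx => ⟨r - (q : ℝ) ^ (2 * (x + 1)), ?_, ?_⟩⟩
  · have := Real.rpow_lt_one q.2.1.le q.2.2 (z := 2 * (x + 1)) (by linarith)
    linarith
  · rw [QParam.val, Complex.ofReal_sub, Complex.ofReal_cpow q.2.1.le]
    push_cast
    rfl

/-- Numerator and denominator of `F` are both negative at large real arguments, since `q⁻² ≥ 1`;
changing both signs gives a quotient of positive functions. -/
lemma fF (q : QParam) : EventuallyPos (fF q) := by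
  have h1 := cst_sub_fQ q (r := (q : ℝ)⁻¹ ^ 2)
    (one_le_pow₀ (one_le_inv_iff₀.2 ⟨q.2.1, q.2.2.le⟩))
  have h2 := cst_sub_fQ q le_rfl
  have h := h1.mul h2.inv
  have : DynSL2.fF q = (DynSL2.cst (((q : ℝ)⁻¹ ^ 2 : ℝ) : ℂ) - fQ q) *
      (DynSL2.cst ((1 : ℝ) : ℂ) - fQ q)⁻¹ := by
    rw [DynSL2.fF, ← div_eq_mul_inv, ← neg_div_neg_eq, neg_sub, neg_sub]
    simp [QParam.val]
  rwa [this]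

end EventuallyPos

/-! ### A representation on functions of two variables -/

/-- The algebra generated by functions of `λ` and functions of `μ`. -/
abbrev BiMer : Type := Mer ⊗[ℂ] Mer

namespace BiMer

/-- Functions of `λ`. -/
noncomputable def inl : Mer →ₐ[ℂ] BiMer := Algebra.TensorProduct.includeLeft

/-- Functions of `μ`. -/
noncomputable def inr : Mer →ₐ[ℂ] BiMer := Algebra.TensorProduct.includeRight

/-- Translation in both variables. -/
noncomputable def bishift (m n : ℂ) : BiMer →ₐ[ℂ] BiMer :=
  Algebra.TensorProduct.map (shift m) (shift n)

lemma bishift_inl (m n : ℂ) (f : Mer) : bishift m n (inl f) = inl (shift m f) := by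
  simp [bishift, inl]

lemma bishift_inr (m n : ℂ) (f : Mer) : bishift m n (inr f) = inr (shift n f) := by
  simp [bishift, inr]

lemma bishift_bishift (m n m' n' : ℂ) (x : BiMer) :
    bishift m n (bishift m' n' x) = bishift (m + m') (n + n') x := by
  induction x using TensorProduct.induction_on with
  | zero => simp only [map_zero]
  | tmul f g => simp [bishift, shift_shift]
  | add x y hx hy => simp only [map_add, hx, hy]

lemma bishift_zero (x : BiMer) : bishift 0 0 x = x := by
  induction x using TensorProduct.induction_on with
  | zero => simp only [map_zero]
  | tmul f g => simp [bishift, shift_zero]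
  | add x y hx hy => simp only [map_add, hx, hy]

/-- A translation followed by multiplication by an element. -/
noncomputable def op (x : BiMer) (m n : ℂ) : Module.End ℂ BiMer :=
  LinearMap.mulLeft ℂ x ∘ₗ (bishift m n).toLinearMap

lemma op_apply (x : BiMer) (m n : ℂ) (y : BiMer) : op x m n y = x * bishift m n y := rfl

lemma op_mul_op (x y : BiMer) (m n m' n' : ℂ) :
    op x m n * op y m' n' = op (x * bishift m n y) (m + m') (n + n') := by
  ext z
  simp [op_apply, bishift_bishift, mul_assoc]

lemma op_sub (x y : BiMer) (m n : ℂ) : op x m n - op y m n = op (x - y) m n := by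
  ext z
  simp [op_apply, sub_mul]

lemma smul_op (z : ℂ) (x : BiMer) (m n : ℂ) : z • op x m n = op (algebraMap ℂ BiMer z * x) m n := by
  ext y
  simp [op_apply, Algebra.smul_def, mul_assoc]

lemma lmul_eq_op (x : BiMer) : Algebra.lmul ℂ BiMer x = op x 0 0 := by
  ext y
  simp [op_apply, bishift_zero]

lemma one_eq_op : (1 : Module.End ℂ BiMer) = op 1 0 0 := by
  rw [← lmul_eq_op, map_one]

lemma exists_linearMap_one_eq_one (k L : Type) [Field k] [Field L] [Algebra k L] :
    ∃ ψ : L →ₗ[k] k, ψ 1 = 1 := by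
  obtain ⟨ψ, hψ⟩ := LinearMap.exists_leftInverse_of_injective (Algebra.linearMap k L)
    (LinearMap.ker_eq_bot.2 (algebraMap k L).injective)
  exact ⟨ψ, by simpa using LinearMap.congr_fun hψ 1⟩

/-- If a function of `λ` agrees with a function of `μ`, then both are constant. -/
lemma exists_cst_of_inl_eq_inr {f g : Mer} (h : inl f = inr g) :
    ∃ z : ℂ, f = cst z ∧ g = cst z := by
  -- The multiplication map `Mer ⊗ Mer → Mer` restricts to the diagonal `λ = μ`.
  have hfg : f = g := by
    simpa [inl, inr] using congrArg (Algebra.TensorProduct.lmul' ℂ (S := Mer)) h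
  obtain ⟨ψ, h1⟩ := exists_linearMap_one_eq_one ℂ Mer
  -- Contracting the second factor with a functional `ψ`, `ψ 1 = 1`, turns `f ⊗ 1 = 1 ⊗ g` into `f =
  -- ψ g`, a constant.
  have h2 := congrArg (fun x => TensorProduct.rid ℂ Mer (ψ.lTensor Mer x)) h
  simp [inl, inr, h1] at h2
  have h3 : f = cst (ψ g) := h2.trans (Algebra.algebraMap_eq_smul_one _).symm
  exact ⟨ψ g, h3, hfg ▸ h3⟩

end BiMer

/-! ### The action of the generators and the verification of the relations. -/

namespace BiMer

variable (q : QParam)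

/-- The coefficient of `β`. -/
noncomputable def cβ : BiMer :=
  (inl (fQ q) + inr (cst q.val ^ 2 * fQ q)) * inl (fu q)⁻¹ * inr (fP q)

/-- The coefficient of `γ`. -/
noncomputable def cγ : BiMer := inl (fu q * shift 1 (fP q))

/-- The coefficient of `δ`. -/
noncomputable def cδ : BiMer :=
  (1 + inl (cst q.val ^ 2 * fQ q) * inr (fQ q)) * inl (shift 1 (fP q)) * inr (fP q)

lemma inl_cst (z : ℂ) : inl (cst z) = algebraMap ℂ BiMer z := inl.commutes z
lemma inr_cst (z : ℂ) : inr (cst z) = algebraMap ℂ BiMer z := inr.commutes z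

/-- The action of the generators. -/
noncomputable def repGen : Gen → Module.End ℂ BiMer
  | .α => op 1 (-1) (-1)
  | .β => op (cβ q) (-1) 1
  | .γ => op (cγ q) 1 (-1)
  | .δ => op (cδ q) 1 1
  | .lam f => op (inl f) 0 0
  | .mu f => op (inr f) 0 0

/-- Operators without translation are multiplications, so `H` formed from operators is the image
under `Algebra.lmul` of `H` formed inside `BiMer`. -/
lemma op_fH (x : BiMer) (m n : ℂ) :
    fH q (fun f => op (inl f) 0 0) (fun f => op (inr f) 0 0) * op x m n =
      op (algebraMap ℂ BiMer (q.val - q.val⁻¹) *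
        ((inl (fQ q) * inr (fQ q) - 1) * (inl (fP q) * inr (fP q))) * x) m n := by
  simp only [← lmul_eq_op]
  rw [← map_fH (q := q) (Algebra.lmul ℂ BiMer) (inl : Mer → BiMer) (inr : Mer → BiMer),
    lmul_eq_op, op_mul_op, bishift_zero, zero_add, zero_add, fH, Algebra.smul_def, fP]

lemma op_fI (x : BiMer) (m n : ℂ) :
    fI q (fun f => op (inl f) 0 0) (fun f => op (inr f) 0 0) * op x m n =
      op (algebraMap ℂ BiMer (q.val - q.val⁻¹) *
        ((inr (fQ q) - inl (fQ q)) * (inl (fP q) * inr (fP q))) * x) m n := by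
  simp only [← lmul_eq_op]
  rw [← map_fI (q := q) (Algebra.lmul ℂ BiMer) (inl : Mer → BiMer) (inr : Mer → BiMer),
    lmul_eq_op, op_mul_op, bishift_zero, zero_add, zero_add, fI, Algebra.smul_def, fP]

lemma fP_mul : fP q * (fQ q - 1) = 1 := by
  simpa [shift_zero] using shift_fP_mul q 0

lemma shift_one_fP_mul : shift 1 (fP q) * (cst q.val ^ 2 * fQ q - 1) = 1 := by
  rw [← shift_one_fQ, shift_fP_mul]

lemma shift_neg_one_fP_mul : shift (-1) (fP q) * (cst q.val⁻¹ ^ 2 * fQ q - 1) = 1 := by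
  rw [← shift_neg_one_fQ, shift_fP_mul]

lemma shift_cst (a z : ℂ) : shift a (cst z) = cst z := (shift a).commutes z

lemma shift_one_fu_inv : shift 1 (fu q)⁻¹ = cst q.val⁻¹ * (fu q)⁻¹ := by
  rw [map_inv₀, shift_one_fu, mul_inv, cst, cst, map_inv₀]

lemma shift_neg_one_fu_inv : shift (-1) (fu q)⁻¹ = cst q.val * (fu q)⁻¹ := by
  rw [map_inv₀, shift_neg_one_fu, mul_inv, cst, cst, map_inv₀, inv_inv]

lemma shift_neg_one_shift_one (f : Mer) : shift (-1) (shift 1 f) = f := by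
  rw [shift_shift, neg_add_cancel, shift_zero]

lemma op_congr {x y : BiMer} {m n m' n' : ℂ} (h : x = y) (hm : m = m') (hn : n = n') :
    op x m n = op y m' n' := by
  rw [h, hm, hn]

-- A generator of bidegree `(m, n)` acts with translation by `(-m, -n)`, which is exactly what the
-- dynamical relations demand. In each of the other relations between `α, β, γ, δ`, both sides carry
-- the same translation, so the relation reduces to a rational identity between multipliers.
set_option linter.unusedSimpArgs false in
lemma repGen_rel {x y : FreeAlgebra ℂ Gen} (h : Rel q x y) :
    FreeAlgebra.lift ℂ (repGen q) x = FreeAlgebra.lift ℂ (repGen q) y := by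
  have hs : algebraMap ℂ BiMer q.val * algebraMap ℂ BiMer q.val⁻¹ = 1 := by
    rw [← map_mul, mul_inv_cancel₀ q.ne_zero, map_one]
  have hl : ∀ f g : Mer, f * g = 1 → inl f * inl g = 1 := fun f g h => by
    rw [← map_mul, h, map_one]
  have hr : ∀ f g : Mer, f * g = 1 → inr f * inr g = 1 := fun f g h => by
    rw [← map_mul, h, map_one]
  -- No inverses are available in the ring `BiMer`, so each denominator that occurs enters as an
  -- equation `x * y = 1`; the rational identities then become consequences in a commutative ring.
  have l0 := hl _ _ (fP_mul q)
  have l1 := hl _ _ (shift_one_fP_mul q)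
  have r0 := hr _ _ (fP_mul q)
  have r2 := hr _ _ (shift_neg_one_fP_mul q)
  have u0 := hl _ _ (mul_inv_cancel₀ (fu_ne_zero q))
  simp only [map_sub, map_mul, map_one, map_pow, inl_cst, inr_cst] at l0 l1 r0 r2
  clear hl hr
  cases h with
  | lam_const z => simp only [FreeAlgebra.lift_ι_apply, repGen, ← lmul_eq_op, inl_cst,
      AlgHom.commutes]
  | lam_add f g => simp only [map_add, FreeAlgebra.lift_ι_apply, repGen, ← lmul_eq_op]
  | lam_mul f g => simp only [map_mul, FreeAlgebra.lift_ι_apply, repGen, ← lmul_eq_op]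
  | mu_const z => simp only [FreeAlgebra.lift_ι_apply, repGen, ← lmul_eq_op, inr_cst,
      AlgHom.commutes]
  | mu_add f g => simp only [map_add, FreeAlgebra.lift_ι_apply, repGen, ← lmul_eq_op]
  | mu_mul f g => simp only [map_mul, FreeAlgebra.lift_ι_apply, repGen, ← lmul_eq_op]
  | lam_mu f g =>
    simp only [map_mul, FreeAlgebra.lift_ι_apply, repGen, ← lmul_eq_op]
    rw [← map_mul, ← map_mul, mul_comm]
  | lam_α f | mu_α f | lam_β f | mu_β f | lam_γ f | mu_γ f | lam_δ f | mu_δ f =>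
    simp [repGen, op_mul_op, bishift_inl, bishift_inr, bishift_zero, shift_shift, shift_zero,
      mul_comm]
  | αβ | αγ | βδ | γδ =>
    simp only [map_mul, map_smul, FreeAlgebra.lift_ι_apply, repGen, op_mul_op, smul_op, cβ, cγ, cδ,
      map_one, map_add, bishift_inl, bishift_inr, shift_neg_one_shift_one, shift_zero,
      AlgHom.commutes, shift_one_fQ, shift_neg_one_fQ, fF_eq_mul_fP, map_sub, map_pow,
      shift_one_fu_inv, shift_neg_one_fu_inv, shift_one_fu, shift_neg_one_fu]
    refine op_congr ?_ (by norm_num) (by norm_num)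
    grind
  | cross₁ =>
    rw [map_mul, map_fH]
    simp only [map_sub, map_mul, FreeAlgebra.lift_ι_apply, repGen, op_mul_op, op_fH]
    simp only [map_mul, cβ, cγ, cδ, map_one, map_add, bishift_inl, bishift_inr,
      shift_neg_one_shift_one, AlgHom.commutes, shift_one_fQ, shift_neg_one_fQ, map_sub, map_pow,
      shift_one_fu_inv, neg_add_cancel, add_neg_cancel, op_sub]
    refine op_congr ?_ (by norm_num) (by norm_num)
    grind
  | cross₂ =>
    rw [map_mul, map_fI]
    simp only [map_sub, map_mul, FreeAlgebra.lift_ι_apply, repGen, op_mul_op, op_fI]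
    simp only [map_mul, cβ, cγ, cδ, bishift_zero, map_one, map_add, bishift_inl, bishift_inr,
      shift_neg_one_shift_one, shift_zero, zero_add, AlgHom.commutes, shift_one_fQ,
      shift_neg_one_fQ,
      fG_eq_mul_fP, map_sub, map_pow, shift_one_fu_inv, shift_neg_one_fu, neg_add_cancel,
      add_neg_cancel, op_sub]
    refine op_congr ?_ (by norm_num) (by norm_num)
    grind

end BiMer

/-! ### The representations of the two algebras. -/

open BiMer

/-- The action of `F_R(M(2))` on functions of two variables. -/
noncomputable def FM.rep (q : QParam) : FM q →ₐ[ℂ] Module.End ℂ BiMer :=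
  RingQuot.liftAlgHom ℂ ⟨FreeAlgebra.lift ℂ (repGen q), fun _ _ h => repGen_rel q h⟩

lemma FM.rep_gen (q : QParam) (g : Gen) : FM.rep q (FM.gen q g) = repGen q g := by
  have : FM.rep q (FM.gen q g) = FreeAlgebra.lift ℂ (repGen q) (FreeAlgebra.ι ℂ g) :=
    RingQuot.liftAlgHom_mkAlgHom_apply ℂ _ _ _
  rw [this, FreeAlgebra.lift_ι_apply]

/-- As `α` acts by an invertible translation, `αδ = 1 + qF(λ)γβ` determines the multiplier of `δ`
from those of `β` and `γ`. The element `cδ` is that solution. -/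
lemma FM.rep_det (q : QParam) {x y : FM q} (h : DetRel q x y) : FM.rep q x = FM.rep q y := by
  have hs : algebraMap ℂ BiMer q.val * algebraMap ℂ BiMer q.val⁻¹ = 1 := by
    rw [← map_mul, mul_inv_cancel₀ q.ne_zero, map_one]
  have hl : ∀ f g : Mer, f * g = 1 → inl f * inl g = 1 := fun f g h => by
    rw [← map_mul, h, map_one]
  have hr : ∀ f g : Mer, f * g = 1 → inr f * inr g = 1 := fun f g h => by
    rw [← map_mul, h, map_one]
  have l0 := hl _ _ (fP_mul q)
  have l1 := hl _ _ (shift_one_fP_mul q)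
  have r2 := hr _ _ (shift_neg_one_fP_mul q)
  have u0 := hl _ _ (mul_inv_cancel₀ (fu_ne_zero q))
  simp only [map_sub, map_mul, map_one, map_pow, inl_cst, inr_cst] at l0 l1 r2
  clear hl hr
  cases h
  simp only [map_sub, map_mul, map_smul, ← FM.gen_lam, FM.rep_gen, repGen, op_mul_op, smul_op,
    neg_add_cancel, add_neg_cancel, zero_add, op_sub, one_eq_op, map_one]
  simp only [cβ, cγ, cδ, map_mul,
    map_one, map_add, bishift_inl, bishift_inr, shift_neg_one_shift_one, map_sub,
    AlgHom.commutes, shift_one_fQ, shift_neg_one_fQ, fF_eq_mul_fP, map_pow,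
    shift_one_fu_inv, shift_zero]
  refine op_congr ?_ rfl rfl
  grind

/-- The action of `F_R(SL(2))` on functions of two variables. -/
noncomputable def FSL.rep (q : QParam) : FSL q →ₐ[ℂ] Module.End ℂ BiMer :=
  RingQuot.liftAlgHom ℂ ⟨FM.rep q, fun _ _ h => FM.rep_det q h⟩

lemma FSL.rep_proj (q : QParam) (x : FM q) : FSL.rep q (FSL.proj q x) = FM.rep q x :=
  RingQuot.liftAlgHom_mkAlgHom_apply ℂ _ _ _

/-! ### Restriction to lines in the `(λ, μ)`-plane. -/

namespace BiMer

/-- Restriction to the line `(λ, μ) = (x - n, x + n)`. -/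
noncomputable def ev (n : ℤ) : BiMer →ₐ[ℂ] Mer :=
  Algebra.TensorProduct.productMap (shift (-n)) (shift n)

lemma ev_inl (n : ℤ) (f : Mer) : ev n (inl f) = shift (-n) f := by
  simp [ev, inl]

lemma ev_inr (n : ℤ) (f : Mer) : ev n (inr f) = shift n f := by
  simp [ev, inr]

/-- The translation in the action of `β` carries the line `(x - n, x + n)` to the next one.
Restriction to lines takes values in a field, where products of nonzero elements stay nonzero; this
is used for powers of `β`, whose multiplier is not shown to be a unit. -/
lemma ev_bishift (n : ℤ) (x : BiMer) : ev n (bishift (-1) 1 x) = ev (n + 1) x := by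
  induction x using TensorProduct.induction_on with
  | zero => simp only [map_zero]
  | tmul f g =>
    simp only [ev, bishift, Algebra.TensorProduct.map_tmul,
      Algebra.TensorProduct.productMap_apply_tmul, shift_shift, Int.cast_add, Int.cast_one, neg_add]
  | add x y hx hy => simp only [map_add, hx, hy]

/-- On the line both summands of the first factor of `cβ` become positive multiples of the same
function `q^(2(x+1))`, so they cannot cancel. -/
lemma ev_cβ_ne_zero (q : QParam) (n : ℤ) : ev n (cβ q) ≠ 0 := by
  have h1 : ev n (inl (fQ q) + inr (cst q.val ^ 2 * fQ q)) =
      cst (q.val ^ (2 * -n) + q.val ^ 2 * q.val ^ (2 * n)) * fQ q := by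
    rw [map_add, ev_inl, ev_inr, ← Int.cast_neg, map_mul, map_pow, shift_cst, shift_intCast_fQ,
      shift_intCast_fQ, cst, cst, cst, cst, map_add, map_mul, map_pow]
    ring
  rw [cβ, map_mul, map_mul, h1, ev_inl, ev_inr]
  refine mul_ne_zero (mul_ne_zero (mul_ne_zero ?_ (fQ_ne_zero q)) ?_) ?_
  · have h2 : q.val ^ (2 * -n) + q.val ^ 2 * q.val ^ (2 * n) =
        (((q : ℝ) ^ (2 * -n) + (q : ℝ) ^ 2 * (q : ℝ) ^ (2 * n) : ℝ) : ℂ) := by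
      push_cast; rfl
    have h3 := q.2.1
    rw [Ne, ← cst_zero, cst_injective.eq_iff, h2, Complex.ofReal_eq_zero]
    positivity
  · exact (map_ne_zero _).2 (inv_ne_zero (fu_ne_zero q))
  · exact (map_ne_zero _).2 (inv_ne_zero (fQ_sub_one_ne q))

end BiMer

/-! ### The action of monomials on the vector `1`. -/

namespace FM

variable (q : QParam)

lemma rep_α_pow_one (j : ℕ) : rep q (α q ^ j) 1 = 1 := by
  induction j with
  | zero => simp
  | succ j ih =>
    rw [pow_succ', map_mul, rep_gen, Module.End.mul_apply, ih]
    simp [repGen, op_apply]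

/-- The powers of `α` fix `1`, and the multiplier of `γ` is a nonzero function of `λ` alone, hence
invertible in `BiMer`. -/
lemma isUnit_rep_γ_pow_α_pow (i j : ℕ) : IsUnit (rep q (γ q ^ i * α q ^ j) 1) := by
  induction i with
  | zero => rw [pow_zero, one_mul, rep_α_pow_one]; exact isUnit_one
  | succ i ih =>
    rw [pow_succ', mul_assoc, map_mul, rep_gen, Module.End.mul_apply]
    refine IsUnit.mul ?_ (ih.map (bishift 1 (-1)))
    exact (IsUnit.mk0 _ (mul_ne_zero (fu_ne_zero q)
      ((map_ne_zero _).2 (inv_ne_zero (fQ_sub_one_ne q))))).map inl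

lemma ev_rep_β_pow_α_pow_ne_zero (i j : ℕ) (n : ℤ) : ev n (rep q (β q ^ i * α q ^ j) 1) ≠ 0 := by
  -- All lines are treated together, because each factor `β` passes from the line `n` to the line `n
  -- + 1`.
  induction i generalizing n with
  | zero => rw [pow_zero, one_mul, rep_α_pow_one, map_one]; exact one_ne_zero
  | succ i ih =>
    rw [pow_succ', mul_assoc, map_mul, rep_gen, Module.End.mul_apply, repGen, op_apply, map_mul,
      ev_bishift]
    exact mul_ne_zero (ev_cβ_ne_zero q n) (ih _)

lemma rep_lam_mul_apply (f : Mer) (a : FM q) (x : BiMer) :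
    rep q (lam q f * a) x = inl f * rep q a x := by
  rw [map_mul, ← gen_lam, rep_gen, Module.End.mul_apply, repGen, op_apply, bishift_zero]

lemma rep_mu_mul_apply (f : Mer) (a : FM q) (x : BiMer) :
    rep q (mu q f * a) x = inr f * rep q a x := by
  rw [map_mul, ← gen_mu, rep_gen, Module.End.mul_apply, repGen, op_apply, bishift_zero]

end FM

/-! ### Cancellation of monomials in `F_R(SL(2))`. -/

namespace FSL

open FM

variable {q : QParam}

/-- Applying both sides to `1` and cancelling the unit coming from the monomial leaves `f(λ) = g(μ)`
in `Mer ⊗ Mer`. -/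
lemma exists_cst_of_proj_eq {f g : Mer} {i j : ℕ}
    (h : proj q (lam q f * (γ q ^ i * α q ^ j)) = proj q (FM.mu q g * (γ q ^ i * α q ^ j))) :
    ∃ z : ℂ, f = cst z ∧ g = cst z := by
  have h1 := LinearMap.congr_fun (congrArg (rep q) h) 1
  rw [rep_proj, rep_proj, rep_lam_mul_apply, rep_mu_mul_apply] at h1
  exact exists_cst_of_inl_eq_inr ((isUnit_rep_γ_pow_α_pow q i j).mul_right_cancel h1)

lemma eq_zero_of_proj_lam_mul {f : Mer} {i j : ℕ}
    (h : proj q (lam q f * (γ q ^ i * α q ^ j)) = 0) : f = 0 := by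
  obtain ⟨z, rfl, hz⟩ := exists_cst_of_proj_eq (f := f) (g := 0) (i := i) (j := j)
    (by rw [h, map_zero, zero_mul, map_zero])
  exact hz.symm

/-- With `β` in place of `γ` the vector produced from `1` is only known to be nonzero on lines, so
the equation is restricted to the diagonal `n = 0` and cancelled in the field `Mer`. -/
lemma eq_zero_of_proj_mu_mul {f : Mer} {i j : ℕ}
    (h : proj q (FM.mu q f * (β q ^ i * α q ^ j)) = 0) : f = 0 := by
  have h1 := congrArg (ev 0) (LinearMap.congr_fun (congrArg (rep q) h) 1)
  rw [rep_proj, rep_mu_mul_apply, map_mul, ev_inr, map_zero, LinearMap.zero_apply, map_zero] at h1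
  exact (map_eq_zero _).1 ((mul_eq_zero.1 h1).resolve_right (ev_rep_β_pow_α_pow_ne_zero q i j 0))

end FSL

/-! ### The coproduct of `γ^i α^k`. -/

namespace FM

open Finset.HasAntidiagonal (antidiagonal)

variable (q : QParam)

/-- The coefficients in `α γ ^ m = f(λ) γ ^ m α`. -/
noncomputable def kfun : ℕ → Mer
  | 0 => 1
  | m + 1 => kfun m * shift (m : ℂ) (cst q.val * fF q)

lemma kfun_pos (m : ℕ) : EventuallyPos (kfun q m) := by
  induction m with
  | zero => exact .one
  | succ m ih =>
    have := ((EventuallyPos.cst q.2.1).mul (.fF q)).shift (m : ℝ)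
    rw [Complex.ofReal_natCast] at this
    exact ih.mul this

variable {q}

lemma α_mul_mu (f : Mer) : α q * mu q f = mu q (shift (-1) f) * α q := by
  rw [mu_mul_gen, shift_shift]
  simp [genDeg, shift_zero]

lemma β_mul_mu (f : Mer) : β q * mu q f = mu q (shift 1 f) * β q := by
  rw [mu_mul_gen, shift_shift]
  simp [genDeg, shift_zero]

lemma γ_mul_lam (f : Mer) : γ q * lam q f = lam q (shift 1 f) * γ q := by
  rw [lam_mul_gen, shift_shift]
  simp [genDeg, shift_zero]

lemma γ_pow_mul_lam (m : ℕ) (f : Mer) :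
    γ q ^ m * lam q f = lam q (shift (m : ℂ) f) * γ q ^ m := by
  induction m with
  | zero => simp [shift_zero]
  | succ m ih =>
    rw [pow_succ', mul_assoc, ih, ← mul_assoc, γ_mul_lam, shift_shift, mul_assoc, Nat.cast_succ,
      add_comm]

lemma β_pow_mul_mu (m : ℕ) (f : Mer) :
    β q ^ m * mu q f = mu q (shift (m : ℂ) f) * β q ^ m := by
  induction m with
  | zero => simp [shift_zero]
  | succ m ih =>
    rw [pow_succ', mul_assoc, ih, ← mul_assoc, β_mul_mu, shift_shift, mul_assoc, Nat.cast_succ,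
      add_comm]

lemma α_mul_γ_pow_eq (m : ℕ) : α q * γ q ^ m = lam q (kfun q m) * (γ q ^ m * α q) := by
  induction m with
  | zero => simp [kfun]
  | succ m ih =>
    have h2 : α q * γ q = lam q (cst q.val * fF q) * (γ q * α q) := by
      rw [rel_αγ, map_mul, (lam q).commutes, ← Algebra.smul_def, smul_mul_assoc]
    rw [pow_succ, ← mul_assoc, ih, mul_assoc, mul_assoc, h2, ← mul_assoc (γ q ^ m), γ_pow_mul_lam,
      kfun, map_mul (lam q)]
    simp only [mul_assoc]

/-- The relation for `αβ` is the one for `αγ` with `F(μ-1)` in place of `F(λ)`, and powers of `β`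
translate `μ` as powers of `γ` translate `λ`. Hence the same functions `kfun` occur, shifted by
`-1`. -/
lemma α_mul_β_pow_eq (m : ℕ) :
    α q * β q ^ m = mu q (shift (-1) (kfun q m)) * (β q ^ m * α q) := by
  induction m with
  | zero => simp [kfun]
  | succ m ih =>
    have h2 : α q * β q = mu q (shift (-1) (cst q.val * fF q)) * (β q * α q) := by
      rw [rel_αβ, map_mul, map_mul, (shift (-1)).commutes, (mu q).commutes, ← Algebra.smul_def,
        smul_mul_assoc]
    rw [pow_succ, ← mul_assoc, ih, mul_assoc, mul_assoc, h2, ← mul_assoc (β q ^ m), β_pow_mul_mu,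
      kfun, map_mul (shift (-1)) (kfun q m), map_mul (mu q) (shift (-1) (kfun q m)), shift_shift,
      shift_shift, add_comm]
    simp only [mul_assoc]

/-- The coefficients of `(a ⊗ α + b ⊗ γ) ∑ cₘⱼ ⊗ γ ^ m α ^ j`. -/
noncomputable def coeffStep (a b : FM q) (c : ℕ → ℕ → FM q) (m j : ℕ) : FM q :=
  (match j with
    | 0 => 0
    | j + 1 => mu q (kfun q m) * (a * c m j)) +
  (match m with
    | 0 => 0
    | m + 1 => b * c m j)

/-- Moving `α` past `γ^m` in the second tensor factor creates `kfun(λ)`, and the rule `f(μ)a ⊗ b = a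
⊗ f(λ)b` transfers it to the first factor as `kfun(μ)`. -/
lemma act_sum_tm {a b : FM q} (ha : a ∈ rightDeg q 1) (hb : b ∈ rightDeg q (-1))
    (c : ℕ → ℕ → FM q) (n : ℕ) :
    act (tmul 1 a (α q) ha (mem_left _ rfl) + tmul (-1) b (γ q) hb (mem_left _ rfl))
      (∑ p ∈ antidiagonal n, tm (c p.1 p.2) (γ q ^ p.1 * α q ^ p.2)) =
    ∑ p ∈ antidiagonal (n + 1),
      tm (coeffStep a b c p.1 p.2) (γ q ^ p.1 * α q ^ p.2) := by
  have h0 : ∀ x : FM q, tm 0 x = 0 := fun x => by rw [tm, map_zero, TensorProduct.zero_tmul]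
  simp only [coeffStep, add_tm, Finset.sum_add_distrib]
  -- The term with `j = 0` is split off from the `α`-part and the term with `m = 0` from the
  -- `γ`-part; these are the boundary cases where `coeffStep` contributes `0`.
  rw [Finset.Nat.sum_antidiagonal_succ', Finset.Nat.sum_antidiagonal_succ]
  simp only [h0, zero_add, map_sum, act_add_tmul, Finset.sum_add_distrib]
  congr 1
  · refine Finset.sum_congr rfl fun p _ => ?_
    rw [tm_mu, ← mul_assoc (α q), α_mul_γ_pow_eq, pow_succ']
    simp only [mul_assoc]
  · refine Finset.sum_congr rfl fun p _ => ?_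
    rw [← mul_assoc, pow_succ']

/-- The coefficients of `Δ(γ ^ i α ^ k)`. -/
noncomputable def coeff (i k : ℕ) : ℕ → ℕ → FM q :=
  (coeffStep (γ q) (δ q))^[i] ((coeffStep (α q) (β q))^[k] fun _ _ => 1)

/-- Only the entries of `coeff i k` on the antidiagonal `i + k` have a meaning. They depend on the
initial array of ones only through its entry `(0, 0)`, since each step raises the total index by
one. -/
lemma Δ_γ_pow_mul_α_pow (i k : ℕ) : (Δ q (γ q ^ i * α q ^ k) : TT q) =
    ∑ p ∈ antidiagonal (i + k), tm (coeff i k p.1 p.2) (γ q ^ p.1 * α q ^ p.2) := by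
  induction i with
  | zero =>
    rw [pow_zero, one_mul, zero_add]
    induction k with
    | zero => simp [coeff, coe_one]
    | succ k ih =>
      rw [pow_succ', map_mul, Δ_gen, coe_mul, ih]
      simp only [coeff, Function.iterate_succ_apply', Function.iterate_zero_apply]
      exact act_sum_tm _ _ _ _
  | succ i ih =>
    rw [pow_succ', mul_assoc, map_mul, Δ_gen, coe_mul, ih, Nat.add_right_comm]
    simp only [coeff, Function.iterate_succ_apply']
    exact act_sum_tm _ _ _ _

/-- For `m = 0` only the first branch of the recursion survives, and its factor is `kfun 0 = 1`;
each step just multiplies by `α` or `γ` from the left. -/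
lemma coeff_zero_add (i k : ℕ) : coeff i k 0 (i + k) = γ q ^ i * α q ^ k := by
  induction i with
  | zero =>
    rw [zero_add, pow_zero, one_mul]
    induction k with
    | zero => simp [coeff]
    | succ k ih =>
      simp only [coeff, Function.iterate_succ_apply', Function.iterate_zero_apply] at ih ⊢
      simp [coeffStep, kfun, ih, pow_succ']
  | succ i ih =>
    rw [Nat.add_right_comm]
    simp only [coeff, Function.iterate_succ_apply'] at ih ⊢
    simp [coeffStep, kfun, ih, pow_succ', mul_assoc]

/-- These coefficients of `Δ(α^(m+j))` obey a Pascal-type recursion: two multiples of `β^m α^j` by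
functions of `μ` are added at each step. -/
lemma exists_coeff_zero_eq (m j : ℕ) :
    ∃ f : Mer, f ≠ 0 ∧ coeff 0 (m + j) m j = mu q f * (β q ^ m * α q ^ j) := by
  -- A sum of two nonzero functions may vanish, so the induction carries positivity at large real
  -- arguments, which is stable under sums, products and real translations.
  suffices h : ∀ n m j : ℕ, m + j = n →
      ∃ f : Mer, EventuallyPos f ∧ coeff 0 n m j = mu q f * (β q ^ m * α q ^ j) by
    obtain ⟨f, hf, h⟩ := h _ m j rfl
    exact ⟨f, hf.ne_zero, h⟩
  intro n
  induction n with
  | zero =>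
    intro m j h
    obtain ⟨rfl, rfl⟩ : m = 0 ∧ j = 0 := by omega
    exact ⟨1, .one, by simp [coeff]⟩
  | succ n ih =>
    intro m j h
    have hA : ∀ m j, m + j = n → ∃ f : Mer, EventuallyPos f ∧
        mu q (kfun q m) * (α q * coeff 0 n m j) = mu q f * (β q ^ m * α q ^ (j + 1)) := by
      intro m j h
      obtain ⟨f, hf, hc⟩ := ih m j h
      have hs : ∀ f : Mer, EventuallyPos f → EventuallyPos (shift (-1) f) := fun f hf => by
        simpa using hf.shift (-1)
      refine ⟨kfun q m * (shift (-1) f * shift (-1) (kfun q m)),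
        (kfun_pos q m).mul ((hs f hf).mul (hs _ (kfun_pos q m))), ?_⟩
      rw [hc, ← mul_assoc (α q), α_mul_mu, mul_assoc _ (α q), ← mul_assoc (α q), α_mul_β_pow_eq,
        pow_succ']
      simp only [map_mul, mul_assoc]
    have hB : ∀ m j, m + j = n → ∃ f : Mer, EventuallyPos f ∧
        β q * coeff 0 n m j = mu q f * (β q ^ (m + 1) * α q ^ j) := by
      intro m j h
      obtain ⟨f, hf, hc⟩ := ih m j h
      refine ⟨shift 1 f, by simpa using hf.shift 1, ?_⟩
      rw [hc, ← mul_assoc (β q), β_mul_mu, pow_succ']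
      simp only [mul_assoc]
    have hc : coeff 0 (n + 1) m j = coeffStep (α q) (β q) (coeff 0 n) m j := by
      simp only [coeff, Function.iterate_succ_apply', Function.iterate_zero_apply]
    rw [hc]
    rcases m with _ | m <;> rcases j with _ | j
    · omega
    · obtain ⟨f, hf, h1⟩ := hA 0 j (by omega)
      exact ⟨f, hf, by rw [coeffStep, ← h1, add_zero]⟩
    · obtain ⟨f, hf, h1⟩ := hB m 0 (by omega)
      exact ⟨f, hf, by rw [coeffStep, ← h1, zero_add]⟩
    · obtain ⟨f, hf, h1⟩ := hA (m + 1) j (by omega)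
      obtain ⟨g, hg, h2⟩ := hB m (j + 1) (by omega)
      exact ⟨f + g, hf.add hg, by rw [coeffStep, h1, h2, map_add, add_mul]⟩

end FM

namespace FM

open BiMer

variable {q : QParam}

/-! ### Coordinates on `V_N` -/

/-- Right multiplication by `q^(2(λ+1))` is linear for the left `Mer`-structure, and the commutation
rule makes elements of left degree `n` eigenvectors. As the eigenvalues for distinct `n` differ,
this single operator detects the left degree. -/
lemma mulRight_of_leftDeg {n : ℤ} {a : FM q} (ha : a ∈ leftDeg q n) :
    Via.mulRight (lam q) (lam q (fQ q)) (Via.of (lam q) a) =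
      (cst (q.val ^ (2 * -n)) * fQ q) • Via.of (lam q) a := by
  have h := lam_mul_of_leftDeg ha (shift ((-n : ℤ) : ℂ) (fQ q))
  rw [shift_shift, Int.cast_neg, add_neg_cancel, shift_zero, ← Int.cast_neg, shift_intCast_fQ] at h
  rw [Via.smul_of, h]
  rfl

lemma degree_injective : Function.Injective
    fun n : ℤ => cst (q.val ^ (2 * -n)) * fQ q := by
  intro m n h
  have h1 := cst_injective (mul_right_cancel₀ (fQ_ne_zero q) h)
  rw [QParam.val, ← Complex.ofReal_zpow, ← Complex.ofReal_zpow, Complex.ofReal_inj] at h1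
  have := zpow_right_injective₀ q.2.1 q.2.2.ne h1
  omega

lemma pow_mem_leftDeg {n : ℤ} {a : FM q} (ha : a ∈ leftDeg q n) (m : ℕ) :
    a ^ m ∈ leftDeg q (m * n) := by
  induction m with
  | zero => simpa using one_mem_leftDeg
  | succ m ih =>
    rw [pow_succ]
    convert mul_mem_leftDeg ih ha using 1
    push_cast; ring_nf

lemma γ_pow_mul_α_pow_mem_leftDeg {N k : ℕ} (hk : k ≤ N) :
    γ q ^ (N - k) * α q ^ k ∈ leftDeg q (2 * k - N) := by
  convert mul_mem_leftDeg (pow_mem_leftDeg (mem_left (q := q) .γ (n := -1) rfl) (N - k))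
    (pow_mem_leftDeg (mem_left (q := q) .α (n := 1) rfl) k) using 1
  push_cast [Nat.cast_sub hk]
  ring_nf

lemma γ_pow_mul_α_pow_ne_zero (i j : ℕ) : γ q ^ i * α q ^ j ≠ 0 := by
  intro h
  have := (isUnit_rep_γ_pow_α_pow q i j).map (ev 0)
  rw [h, map_zero, LinearMap.zero_apply, map_zero] at this
  exact not_isUnit_zero this

-- The monomials have the distinct left degrees `2k - N`, so they are nonzero eigenvectors of one
-- operator for distinct eigenvalues.
variable (q) in
lemma linearIndependent_γ_pow_mul_α_pow (N : ℕ) : LinearIndependent Mer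
    (fun k : Fin (N + 1) => Via.of (lam q) (γ q ^ (N - (k : ℕ)) * α q ^ (k : ℕ))) := by
  refine Module.End.eigenvectors_linearIndependent'
    (Via.mulRight (lam q) (lam q (fQ q)))
    (fun k : Fin (N + 1) => cst (q.val ^ (2 * -(2 * ((k : ℕ) : ℤ) - (N : ℤ)))) * fQ q)
    (fun k l h => ?_) _ (fun k => ⟨?_, ?_⟩)
  · have := degree_injective h
    exact Fin.ext (by omega)
  · rw [Module.End.mem_eigenspace_iff]
    exact mulRight_of_leftDeg (γ_pow_mul_α_pow_mem_leftDeg (Nat.lt_succ_iff.1 k.2))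
  · exact (LinearEquiv.map_ne_zero_iff _).2 (γ_pow_mul_α_pow_ne_zero _ _)

variable (q) in
/-- The basis `γ ^ (N - k) α ^ k` of `V_N`. -/
noncomputable def basisV (N : ℕ) : Module.Basis (Fin (N + 1)) Mer (V q N) :=
  Module.Basis.span (linearIndependent_γ_pow_mul_α_pow q N)

lemma coe_basisV {N : ℕ} (k : Fin (N + 1)) :
    (basisV q N k : Via (lam q)) = Via.of (lam q) (γ q ^ (N - (k : ℕ)) * α q ^ (k : ℕ)) :=
  congrArg Subtype.val (Module.Basis.span_apply (linearIndependent_γ_pow_mul_α_pow q N) k)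

/-- The grading of `V_N` is inherited from the whole algebra, so it says nothing directly about
coordinates. The eigenvalue equation for `v`, expanded in the basis, does. -/
lemma coord_eq_zero {N : ℕ} {n : ℤ} {v : V q N} (hv : v ∈ grV q N n) {k : Fin (N + 1)}
    (hk : 2 * ((k : ℕ) : ℤ) - N ≠ n) : (basisV q N).coord k v = 0 := by
  obtain ⟨a, ha, hav⟩ := hv
  have h1 : Via.mulRight (lam q) (lam q (fQ q)) (v : Via (lam q)) =
      (cst (q.val ^ (2 * -n)) * fQ q) • (v : Via (lam q)) := by
    have := mulRight_of_leftDeg ha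
    have hav : Via.of (lam q) a = (v : Via (lam q)) := hav
    rwa [hav] at this
  have h2 : (v : Via (lam q)) = ∑ j, (basisV q N).coord j v •
      Via.of (lam q) (γ q ^ (N - (j : ℕ)) * α q ^ (j : ℕ)) := by
    have := congrArg (V q N).subtype ((basisV q N).sum_repr v).symm
    rw [map_sum] at this
    refine this.trans (Finset.sum_congr rfl fun j _ => ?_)
    rw [map_smul, Submodule.subtype_apply, coe_basisV, Module.Basis.coord_apply]
  rw [h2, map_sum, Finset.smul_sum, ← sub_eq_zero, ← Finset.sum_sub_distrib] at h1
  -- The relation so obtained has as coefficients the coordinates of `v` times differences of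
  -- eigenvalues; the difference at `k` is nonzero as the degrees differ.
  have h3 := Fintype.linearIndependent_iff.1 (linearIndependent_γ_pow_mul_α_pow q N)
    (fun j => (basisV q N).coord j v *
      (cst (q.val ^ (2 * -(2 * ((j : ℕ) : ℤ) - (N : ℤ)))) * fQ q - cst (q.val ^ (2 * -n)) * fQ q))
    (by
      rw [← h1]
      refine Finset.sum_congr rfl fun j _ => ?_
      rw [map_smul, mulRight_of_leftDeg (γ_pow_mul_α_pow_mem_leftDeg (Nat.lt_succ_iff.1 j.2)),
        smul_smul, smul_smul, ← sub_smul, mul_sub, mul_comm (cst (q.val ^ (2 * -n)) * fQ q)]) k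
  refine (mul_eq_zero.1 h3).resolve_right fun h => hk ?_
  exact degree_injective (sub_eq_zero.1 h)

open Finset.HasAntidiagonal (antidiagonal) in
lemma sum_antidiagonal_eq_sum_fin {X : Type} [AddCommMonoid X] (N : ℕ) (F : ℕ → ℕ → X) :
    ∑ p ∈ antidiagonal N, F p.1 p.2 = ∑ j : Fin (N + 1), F (N - j) j := by
  rw [← Finset.Nat.sum_antidiagonal_swap]
  exact (Finset.Nat.sum_antidiagonal_eq_sum_range_succ (fun i j => F j i) N).trans
    (Fin.sum_univ_eq_sum_range (fun j => F (N - j) j) (N + 1)).symm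

lemma coactionM_smul_basisV {N : ℕ} (f : Mer) (k : Fin (N + 1)) :
    (coactionM q N (f • basisV q N k) : Via (mu q) ⊗[Mer] V q N) =
      ∑ j : Fin (N + 1), Via.of (mu q) (lam q f * coeff (N - k) k (N - j) j) ⊗ₜ[Mer]
        basisV q N j := by
  -- The identity is compared inside `A ⊗ A`, where the coaction is the coproduct itself.
  apply incl_injective
  have h : (Via.of (lam q)).symm ((f • basisV q N k : V q N) : Via (lam q)) =
      lam q f * (γ q ^ (N - (k : ℕ)) * α q ^ (k : ℕ)) := by
    rw [Submodule.coe_smul, coe_basisV, Via.smul_of, LinearEquiv.symm_apply_apply]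
  rw [incl_coactionM, h, map_mul, ← gen_lam, Δ_gen, coe_mul, Δ_γ_pow_mul_α_pow,
    Nat.sub_add_cancel (Nat.lt_succ_iff.1 k.2),
    sum_antidiagonal_eq_sum_fin N fun m j => tm (coeff (N - k) k m j) (γ q ^ m * α q ^ j),
    map_sum, map_sum]
  refine Finset.sum_congr rfl fun j _ => ?_
  rw [incl, LinearMap.lTensor_tmul, Submodule.subtype_apply, coe_basisV]
  exact act_Δlam f _ _

end FM

/-! ### Matrix entries of intertwiners and Schur's lemma. -/

namespace FSL

open FM

variable {q : QParam}

lemma coaction_smul_basisV {N : ℕ} (f : Mer) (k : Fin (N + 1)) :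
    (coaction q N (f • basisV q N k) : Via (mu q) ⊗[Mer] V q N) =
      ∑ j : Fin (N + 1), Via.of (mu q) (proj q (lam q f * coeff (N - k) k (N - j) j)) ⊗ₜ[Mer]
        basisV q N j := by
  change (projVia q).rTensor (V q N) (coactionM q N (f • basisV q N k)) = _
  rw [coactionM_smul_basisV, map_sum]
  rfl

variable (q) in
/-- The coefficient of a basis vector of `V_N` in an element of `A ⊗ V_N`. -/
noncomputable def coeffAt (N : ℕ) (j : Fin (N + 1)) :
    Via (mu q) ⊗[Mer] V q N →ₗ[Mer] Via (mu q) :=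
  (TensorProduct.rid Mer (Via (mu q))).toLinearMap ∘ₗ
    ((basisV q N).coord j).lTensor (Via (mu q))

lemma coeffAt_tmul {N : ℕ} (j : Fin (N + 1)) (x : Via (mu q)) (v : V q N) :
    coeffAt q N j (x ⊗ₜ v) = (basisV q N).coord j v • x := by
  simp [coeffAt]

variable {M N : ℕ} {φ : V q M →ₗ[Mer] V q N}

/-- The intertwining property in coordinates. -/
lemma IsIntertwiner.sum_eq (hφ : IsIntertwiner φ) (k : Fin (M + 1)) (j : Fin (N + 1)) :
    ∑ i : Fin (N + 1), proj q (lam q ((basisV q N).coord i (φ (basisV q M k))) *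
        coeff (N - i) i (N - j) j) =
      ∑ i : Fin (M + 1), proj q (FM.mu q ((basisV q N).coord j (φ (basisV q M i))) *
        coeff (M - k) k (M - i) i) := by
  have h := congrArg (coeffAt q N j) (hφ.coaction_map (basisV q M k))
  have h1 := coaction_smul_basisV (q := q) 1 k
  rw [one_smul] at h1
  have h2 : φ (basisV q M k) = ∑ i, (basisV q N).coord i (φ (basisV q M k)) • basisV q N i := by
    simp
  rw [h1, map_sum, map_sum] at h
  -- Only the side `π_N ∘ φ` is expanded in the basis, which gives functions of `λ`. On the side
  -- `(id ⊗ φ) ∘ π_M` the coordinate of `φ` acts on the first tensor factor through the right moment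
  -- map, hence as a function of `μ`.
  conv_lhs at h => rw [h2, map_sum, Submodule.coe_sum, map_sum]
  simp only [coaction_smul_basisV, map_sum, coeffAt_tmul, LinearMap.lTensor_tmul,
    Module.Basis.coord_apply, Module.Basis.repr_self, Finsupp.single_apply, ite_smul, one_smul,
    zero_smul, Finset.sum_ite_eq', Finset.mem_univ, if_true,
    Via.smul_of, map_one, one_mul] at h
  simp only [map_mul (proj q) (FM.mu q _)]
  refine (Via.of (mu q)).injective ?_
  rw [map_sum, map_sum]
  exact h

lemma IsIntertwiner.coord_eq_zero (hφ : IsIntertwiner φ) {k : Fin (M + 1)} {i : Fin (N + 1)}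
    (h : 2 * ((i : ℕ) : ℤ) - N ≠ 2 * ((k : ℕ) : ℤ) - M) :
    (basisV q N).coord i (φ (basisV q M k)) = 0 := by
  refine FM.coord_eq_zero (hφ.map_gr _ _ ?_) h
  refine ⟨_, γ_pow_mul_α_pow_mem_leftDeg (Nat.lt_succ_iff.1 k.2), ?_⟩
  exact (coe_basisV k).symm

/-- The last column is chosen because the matrix entries of `π_N` there are the monomials `γ^(N-i)
α^i`, which can be cancelled. -/
lemma IsIntertwiner.sum_last_eq (hφ : IsIntertwiner φ) (k : Fin (M + 1)) :
    ∑ i : Fin (N + 1), proj q (lam q ((basisV q N).coord i (φ (basisV q M k))) *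
        (γ q ^ (N - (i : ℕ)) * α q ^ (i : ℕ))) =
      ∑ i : Fin (M + 1), proj q (FM.mu q ((basisV q N).coord (Fin.last N) (φ (basisV q M i))) *
        coeff (M - k) k (M - i) i) := by
  rw [← hφ.sum_eq]
  refine Finset.sum_congr rfl fun i _ => ?_
  have := coeff_zero_add (q := q) (N - (i : ℕ)) i
  rw [Nat.sub_add_cancel (Nat.lt_succ_iff.1 i.2)] at this
  rw [Fin.val_last, Nat.sub_self, this]

/-- A vanishing last row of `φ` makes the right side of `sum_last_eq` zero. By the grading the left
side is a single term `φ_ik(λ) γ^(N-i) α^i`, so `φ_ik = 0`. -/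
lemma IsIntertwiner.eq_zero (hφ : IsIntertwiner φ)
    (h : ∀ k, (basisV q N).coord (Fin.last N) (φ (basisV q M k)) = 0) : φ = 0 := by
  refine (basisV q M).ext fun k => (basisV q N).ext_elem fun i => ?_
  rw [LinearMap.zero_apply, map_zero, Finsupp.zero_apply]
  change (basisV q N).coord i (φ (basisV q M k)) = 0
  by_cases hd : 2 * ((i : ℕ) : ℤ) - N = 2 * ((k : ℕ) : ℤ) - M
  · have h1 := hφ.sum_last_eq k
    simp only [h, map_zero, zero_mul, Finset.sum_const_zero] at h1
    rw [Finset.sum_eq_single i (fun j _ hj => ?_) (by simp)] at h1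
    · exact eq_zero_of_proj_lam_mul h1
    · rw [hφ.coord_eq_zero, map_zero, zero_mul, map_zero]
      have : (j : ℕ) ≠ i := fun h => hj (Fin.ext h)
      omega
  · exact hφ.coord_eq_zero hd

lemma IsIntertwiner.eq_zero_of_ne (hφ : IsIntertwiner φ) (hMN : M ≠ N) : φ = 0 := by
  refine hφ.eq_zero fun k => ?_
  -- The grading leaves only `2k = M + N`. Since `k ≤ M` and `M ≠ N`, this means `N < M`.
  by_cases hd : 2 * (N : ℤ) - N = 2 * ((k : ℕ) : ℤ) - M
  · have hk := k.2
    have h1 := hφ.sum_last_eq (Fin.last M)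
    rw [Finset.sum_eq_zero fun i _ => ?_, Finset.sum_eq_single k (fun j _ hj => ?_) (by simp)] at h1
    -- The vector `α^M` was chosen, so the surviving matrix entry is a coefficient of `Δ(α^M)`, a
    -- nonzero function of `μ` times `β^(M-k) α^k`.
    · obtain ⟨f, hf, hc⟩ := exists_coeff_zero_eq (q := q) (M - k) k
      rw [Nat.sub_add_cancel (Nat.lt_succ_iff.1 k.2)] at hc
      rw [Fin.val_last, Nat.sub_self, hc, ← mul_assoc, ← map_mul] at h1
      exact (mul_eq_zero.1 (eq_zero_of_proj_mu_mul h1.symm)).resolve_right hf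
    · rw [hφ.coord_eq_zero, map_zero, zero_mul, map_zero]
      have : (j : ℕ) ≠ k := fun h => hj (Fin.ext h)
      rw [Fin.val_last]
      omega
    -- The degree `M` of `α^M` exceeds every degree `2i - N ≤ N` of `V_N`, so the image of `α^M` has
    -- no coordinates.
    · have hi := i.2
      rw [hφ.coord_eq_zero, map_zero, zero_mul, map_zero]
      rw [Fin.val_last]
      omega
  · exact hφ.coord_eq_zero (by rwa [Fin.val_last])

/-- The degrees `2k - N` are distinct, so `φ` is diagonal. The last column then compares each
diagonal entry, as a function of `λ`, with the last one, as a function of `μ`, in front of the same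
monomial. -/
lemma IsIntertwiner.exists_eq_smul {φ : V q N →ₗ[Mer] V q N} (hφ : IsIntertwiner φ) :
    ∃ z : ℂ, ∀ v, φ v = z • v := by
  have h0 : ∀ k i : Fin (N + 1), i ≠ k → (basisV q N).coord i (φ (basisV q N k)) = 0 := by
    intro k i hik
    refine hφ.coord_eq_zero ?_
    have : (i : ℕ) ≠ k := fun h => hik (Fin.ext h)
    omega
  have h1 : ∀ k, ∃ z : ℂ, (basisV q N).coord k (φ (basisV q N k)) = cst z ∧
      (basisV q N).coord (Fin.last N) (φ (basisV q N (Fin.last N))) = cst z := by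
    intro k
    have h := hφ.sum_last_eq k
    rw [Finset.sum_eq_single k (fun j _ hj => by rw [h0 k j hj, map_zero, zero_mul, map_zero])
      (by simp), Finset.sum_eq_single (Fin.last N)
      (fun j _ hj => by rw [h0 j _ hj.symm, map_zero, zero_mul, map_zero]) (by simp)] at h
    have hc := coeff_zero_add (q := q) (N - (k : ℕ)) k
    rw [Nat.sub_add_cancel (Nat.lt_succ_iff.1 k.2)] at hc
    rw [Fin.val_last, Nat.sub_self, hc] at h
    exact exists_cst_of_proj_eq h
  obtain ⟨z, -, hz⟩ := h1 (Fin.last N)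
  refine ⟨z, fun v => ?_⟩
  have h2 : φ = cst z • LinearMap.id := by
    refine (basisV q N).ext fun k => (basisV q N).ext_elem fun i => ?_
    rw [LinearMap.smul_apply, LinearMap.id_apply, map_smul, Finsupp.smul_apply,
      Module.Basis.repr_self, Finsupp.single_apply]
    change (basisV q N).coord i (φ (basisV q N k)) = _
    split_ifs with h
    · subst h
      -- The constant `w` found for `k` is also the value of the last diagonal entry, hence agrees
      -- with `z`.
      obtain ⟨w, hw, hw'⟩ := h1 k
      rw [hw, ← hw', hz, smul_eq_mul, mul_one]
    · rw [h0 k i (Ne.symm h), smul_zero]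
  rw [h2, LinearMap.smul_apply, LinearMap.id_apply, algebraMap_smul]

end FSL

end DynSL2

theorem mainTheorem3 (q : DynSL2.QParam) :
    (∀ (M N : ℕ), M ≠ N → ∀ φ : DynSL2.FM.V q M →ₗ[DynSL2.Mer] DynSL2.FM.V q N,
      DynSL2.FSL.IsIntertwiner φ → φ = 0) ∧
    (∀ (N : ℕ) (φ : DynSL2.FM.V q N →ₗ[DynSL2.Mer] DynSL2.FM.V q N),
      DynSL2.FSL.IsIntertwiner φ → ∃ Z : ℂ, ∀ v : DynSL2.FM.V q N, φ v = Z • v) :=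
  ⟨fun _ _ h _ hφ => hφ.eq_zero_of_ne h, fun _ _ hφ => hφ.exists_eq_smul⟩
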